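/- Definitions. A double even code is a subspace $V\subseteq\mathbf F_2^n$ with $|v|\equiv 0 \pmod 4$ and $|u\cap v|\equiv 0\pmod 2$ for all $u,v\in V$. A factor set of $V$ is a map $\phi:V\times V\to\{1,-1\}$ with $\phi(v,v)=(-1)^{|v|/4}$, $\phi(v,w)=(-1)^{|v\cap w|/2}\phi(w,v)$, $\phi(0,v)=\phi(v,0)=1$ and $\phi(v+w,u)=\phi(v,w+u)\phi(v,w)\phi(w,u)(-1)^{|v\cap w\cap u|}$. The code loop $L(V)$ is the set $\{1,-1\}\times V$ with the product $(\varepsilon,v)(\delta,w)=(\varepsilon\delta\phi(v,w),v+w)$; its rank is $\dim V$, and $\pm1$ denotes the element $(\pm1,0)$. For a code loop $L$ generated by $a,b,c,d$ with $(a,b,c)=-1$ and $(a,b,d)=(a,c,d)=(b,c,d)=1$, the vector $\lambda=(\lambda_1\dots\lambda_{10})\in\mathbf F_2^{10}$ with $$a^2=(-1)^{\lambda_1},\ b^2=(-1)^{\lambda_2},\ c^2=(-1)^{\lambda_3},\ d^2=(-1)^{\lambda_4},$$ $$[a,b]=(-1)^{\lambda_5},\ [a,c]=(-1)^{\lambda_6},\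 [a,d]=(-1)^{\lambda_7},\ [b,c]=(-1)^{\lambda_8},\ [b,d]=(-1)^{\lambda_9},\ [c,d]=(-1)^{\lambda_{10}}$$ is called a (normalized) characteristic vector of $L$. Here $[u,v]=c$ means $uv=(vu)c$, and $(u,v,w)=c$ means $(uv)w=c\,(u(vw))$. Let $\mathcal F_4$ be the loop of all formal products $\sigma z$, where $\sigma\subseteq\{1,2,3,4\}$ and $z$ lies in the $\mathbf F_2$-space $\mathcal Z$ (written multiplicatively) with basis $\bar i$, $i\wedge j$ $(i<j)$, $i\wedge j\wedge k$ $(i<j<k)$, indices in $\{1,2,3,4\}$, with the product $$(\sigma z)(\mu z')=(\sigma\,\Delta\,\mu)\; z z'\prod_{i\in\sigma\cap\mu}\bar i\ \prod_{i\in\sigma,\,j\in\mu,\,i>j} i\wedge j\ \prod_{i\in\sigma,\ j,k\in\mu,\ j<k} i\wedge j\wedge k,$$ where $i\wedge j$ and $i\wedge j\wedge k$ are symmetric in their indices and equal to $1$ when two indices coincide. (It is the free loop of rank 4 in the variety generated by code loops.) A vector $\lambda\in\mathbf F_2^{10}$ is extended by the coefficient $1$ at $1\wedge2\wedge3$ and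 $0$ at the other $i\wedge j\wedge k$, the coordinates $\lambda_1,\dots,\lambda_4$ belonging to $\bar1,\dots,\bar4$ and $\lambda_5,\dots,\lambda_{10}$ to $1\wedge2,1\wedge3,1\wedge4,2\wedge3,2\wedge4,3\wedge4$; let $T_\lambda\subset\mathcal Z$ be the kernel of the resulting linear functional $\mathcal Z\to\mathbf F_2$. The orbit of $\lambda$ is the set of all $\mu\in\mathbf F_2^{10}$ such that $T_\lambda^\varphi=T_\mu$ for some $\varphi\in\mathrm{Aut}\,\mathcal F_4$. (The action on hyperplanes of $\mathcal Z$ factors through $GL_4(2)$.) Theorem. For each $i=1,\dots,16$ there is, up to isomorphism, exactly one code loop $C_i^4$ of rank $4$ with the characteristic vector $\lambda(C_i^4)$ in the following list: $$\begin{array}{llll} C_1^4:\ (1110110100) & C_2^4:\ (0000000000) & C_3^4:\ (0000110100) & C_4^4:\ (0010100000)\\ C_5^4:\ (0000010100) & C_6^4:\ (1111110100) & C_7^4:\ (0001000000) & C_8^4:\ (0000001000)\\ C_9^4:\ (0100001000) & C_{10}^4:\ (0001111000) & C_{11}^4:\ (0001001000) & C_{12}^4:\ (0000001100)\\ C_{13}^4:\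 (0110111100) & C_{14}^4:\ (0001001100) & C_{15}^4:\ (1001001100) & C_{16}^4:\ (0001111100) \end{array}$$ These sixteen loops are nonassociative, every nonassociative code loop of rank $4$ is isomorphic to exactly one of them, and no two of them are isomorphic. If $O_i^4$ denotes the orbit of $\lambda(C_i^4)$, then $|O_1^4|=1$, $|O_2^4|=|O_3^4|=7$, $|O_4^4|=21$, $|O_5^4|=|O_{14}^4|=|O_{15}^4|=28$, $|O_6^4|=8$, $|O_7^4|=|O_8^4|=|O_{13}^4|=56$, $|O_9^4|=|O_{12}^4|=|O_{16}^4|=168$, $|O_{10}^4|=|O_{11}^4|=112$. -/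

import Mathlib

/-! ### Doubly even codes, factor sets and code loops -/

/-- `|v|`, the number of coordinates of a binary vector that are equal to `1`. -/
def binWeight {n : ℕ} (v : Fin n → ZMod 2) : ℕ :=
  (Finset.univ.filter fun i => v i = 1).card

/-- `u ∩ v`: the vector that is `1` exactly where both `u` and `v` are `1`. -/
def binInter {n : ℕ} (u v : Fin n → ZMod 2) : Fin n → ZMod 2 := fun i => u i * v i

/-- Double even binary linear codes of length `n`. -/
structure IsDoublyEven {n : ℕ} (V : Submodule (ZMod 2) (Fin n → ZMod 2)) : Prop where
  weight : ∀ v ∈ V, 4 ∣ binWeight v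
  inter : ∀ u ∈ V, ∀ v ∈ V, 2 ∣ binWeight (binInter u v)

/-- Factor sets `φ : V × V → {1, -1}` of a double even code `V`. -/
structure IsFactorSet {n : ℕ} (V : Submodule (ZMod 2) (Fin n → ZMod 2))
    (φ : V → V → ℤˣ) : Prop where
  self : ∀ v : V, φ v v = (-1) ^ (binWeight (v : Fin n → ZMod 2) / 4)
  comm : ∀ v w : V, φ v w = (-1) ^ (binWeight (binInter (v : Fin n → ZMod 2) w) / 2) * φ w v
  zero_left : ∀ v : V, φ 0 v = 1
  zero_right : ∀ v : V, φ v 0 = 1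
  assoc : ∀ v w u : V, φ (v + w) u = φ v (w + u) * φ v w * φ w u *
    (-1) ^ binWeight (binInter (binInter (v : Fin n → ZMod 2) w) u)

/-- The data from which a code loop is built: a double even code with a factor set. -/
structure CodeLoop where
  /-- the length of the code -/
  length : ℕ
  /-- the code -/
  code : Submodule (ZMod 2) (Fin length → ZMod 2)
  doublyEven : IsDoublyEven code
  /-- the factor set -/
  factor : code → code → ℤˣ
  isFactorSet : IsFactorSet code factor

namespace CodeLoop

/-- The underlying set `{1, -1} × V` of the code loop `L(V)`; the pair `(ε, v)` is `ε v`. -/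
@[ext]
structure Carrier (L : CodeLoop) where
  /-- the sign -/
  sign : ℤˣ
  /-- the code word -/
  word : L.code

/-- The product of `L(V)`: `(ε v) (δ w) = ε δ φ(v, w) (v + w)`. -/
instance (L : CodeLoop) : Mul L.Carrier where
  mul x y := ⟨x.sign * y.sign * L.factor x.word y.word, x.word + y.word⟩

/-- The rank of a code loop `L(V)` is the dimension of `V`. -/
noncomputable def rank (L : CodeLoop) : ℕ := Module.finrank (ZMod 2) L.code

/-- `L` is nonassociative, i.e. not a group. -/
def Nonassociative (L : CodeLoop) : Prop :=
  ∃ x y z : L.Carrier, x * y * z ≠ x * (y * z)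

/-- Isomorphism of code loops. -/
def Iso (L M : CodeLoop) : Prop := Nonempty (L.Carrier ≃* M.Carrier)

/-- The element `(-1)^e` of `L`, for `e` in the field with two elements. -/
def signElt (L : CodeLoop) (e : ZMod 2) : L.Carrier := ⟨(-1) ^ e.val, 0⟩

end CodeLoop

/-! ### Characteristic vectors -/

/-- Index set of the pairs `i < j`. -/
abbrev IncPair (n : ℕ) : Type := {p : Fin n × Fin n // p.1 < p.2}

/-- Index set of the triples `i < j < k`. -/
abbrev IncTriple (n : ℕ) : Type := {t : Fin n × Fin n × Fin n // t.1 < t.2.1 ∧ t.2.1 < t.2.2}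

/-- Vectors `(λ_i; λ_ij; λ_ijk)` over the field with two elements, indexed by the `i`, the pairs
`i < j` and the triples `i < j < k`. -/
abbrev TriVec (n : ℕ) : Type :=
  (Fin n → ZMod 2) × (IncPair n → ZMod 2) × (IncTriple n → ZMod 2)

/-- `l` is the characteristic vector of `L` with respect to the generators `x_1, …, x_n`:
`x_i ^ 2 = (-1)^{λ_i}`, `[x_i, x_j] = (-1)^{λ_ij}` for `i < j` and `(x_i, x_j, x_k) = (-1)^{λ_ijk}`
for `i < j < k`. The commutator `[u, v]` is the element `c` with `u v = (v u) c`, and the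
associator `(u, v, w)` is the element `c` with `(u v) w = c (u (v w))`. As `L` is finite, a subset
closed under multiplication is a subloop, so `Subsemigroup.closure` (which needs no associativity)
is the subloop generated by a nonempty set. -/
structure CodeLoop.IsCharVector (L : CodeLoop) {n : ℕ} (x : Fin n → L.Carrier)
    (l : TriVec n) : Prop where
  generates : Subsemigroup.closure (Set.range x) = ⊤
  square : ∀ i, x i * x i = L.signElt (l.1 i)
  commutator : ∀ p : IncPair n,
    x p.1.1 * x p.1.2 = (x p.1.2 * x p.1.1) * L.signElt (l.2.1 p)
  associator : ∀ t : IncTriple n,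
    (x t.1.1 * x t.1.2.1) * x t.1.2.2 =
      L.signElt (l.2.2 t) * (x t.1.1 * (x t.1.2.1 * x t.1.2.2))

/-- A vector of ten coordinates
`(a², b², c², d², [a,b], [a,c], [a,d], [b,c], [b,d], [c,d])` (in exponents of `-1`),
completed by the normalization `(a,b,c) = -1`, `(a,b,d) = (a,c,d) = (b,c,d) = 1`. -/
def normalized (m : Fin 10 → ZMod 2) : TriVec 4 :=
  (![m 0, m 1, m 2, m 3],
   fun p => !![0, m 4, m 5, m 6;
               0, 0,   m 7, m 8;
               0, 0,   0,   m 9;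
               0, 0,   0,   0] p.1.1 p.1.2,
   fun t => if t.1 = (0, 1, 2) then 1 else 0)

/-- The sixteen characteristic vectors; `charVec i` is the one of the loop with number `i + 1`. -/
def charVec : Fin 16 → Fin 10 → ZMod 2 :=
  ![![1,1,1,0,1,1,0,1,0,0],
    ![0,0,0,0,0,0,0,0,0,0],
    ![0,0,0,0,1,1,0,1,0,0],
    ![0,0,1,0,1,0,0,0,0,0],
    ![0,0,0,0,0,1,0,1,0,0],
    ![1,1,1,1,1,1,0,1,0,0],
    ![0,0,0,1,0,0,0,0,0,0],
    ![0,0,0,0,0,0,1,0,0,0],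
    ![0,1,0,0,0,0,1,0,0,0],
    ![0,0,0,1,1,1,1,0,0,0],
    ![0,0,0,1,0,0,1,0,0,0],
    ![0,0,0,0,0,0,1,1,0,0],
    ![0,1,1,0,1,1,1,1,0,0],
    ![0,0,0,1,0,0,1,1,0,0],
    ![1,0,0,1,0,0,1,1,0,0],
    ![0,0,0,1,1,1,1,1,0,0]]

/-! ### The free loop of rank `n` and the action of its automorphisms on characteristic vectors -/

/-- The underlying set `V · V̄ · W · U` of the free loop `F_n`. The component `vec` is a subset of
`{1, …, n}`, written as an indicator vector; the component `cen` records the exponents of the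
`ī = i²`, of the `i ∧ j = [i, j]` with `i < j` and of the `i ∧ j ∧ k = (i, j, k)` with
`i < j < k`. -/
@[ext]
structure FreeCodeLoop (n : ℕ) where
  /-- the component in `V` -/
  vec : Fin n → ZMod 2
  /-- the component in `V̄ · W · U` -/
  cen : TriVec n

/-- The central factor of the product of the subsets `σ` and `μ`:
the product of the `ī` with `i ∈ σ ∩ μ`, of the `i ∧ j` with `i ∈ σ`, `j ∈ μ`, `i > j`, and of the
`i ∧ j ∧ k` with `i ∈ σ`, `j, k ∈ μ`, `j < k` (where `i ∧ j ∧ k` is symmetric and vanishes unless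
`i, j, k` are distinct). -/
def freeCocycle {n : ℕ} (σ μ : Fin n → ZMod 2) : TriVec n :=
  (fun i => σ i * μ i,
   fun p => σ p.1.2 * μ p.1.1,
   fun t => σ t.1.1 * (μ t.1.2.1 * μ t.1.2.2) + σ t.1.2.1 * (μ t.1.1 * μ t.1.2.2)
     + σ t.1.2.2 * (μ t.1.1 * μ t.1.2.1))

instance (n : ℕ) : Mul (FreeCodeLoop n) where
  mul x y := ⟨x.vec + y.vec, x.cen + y.cen + freeCocycle x.vec y.vec⟩

/-- The value at the central element `z` of the functional on `V̄ · W · U` given by `l`. -/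
def TriVec.pair {n : ℕ} (l z : TriVec n) : ZMod 2 :=
  ∑ i, l.1 i * z.1 i + ∑ p, l.2.1 p * z.2.1 p + ∑ t, l.2.2 t * z.2.2 t

/-- `T_λ`, the subspace of the center `V̄ · W · U` of `F_n` spanned by the `ī`, `i ∧ j`,
`i ∧ j ∧ k` with coefficient `0` in `λ` and by the products of two of those with coefficient `1`.
This is the kernel of the functional given by `λ`. -/
def charSubspace {n : ℕ} (l : TriVec n) : Set (FreeCodeLoop n) :=
  {g | g.vec = 0 ∧ TriVec.pair l g.cen = 0}

/-- The orbit of a normalized characteristic vector of rank `4`: all the normalized vectors `m`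
for which some automorphism of `F_4` carries `T_l` onto `T_m`. The automorphisms act on the
subspaces through the quotient `GL_4(2)` of the automorphism group. -/
def charOrbit (l : Fin 10 → ZMod 2) : Set (Fin 10 → ZMod 2) :=
  {m | ∃ φ : FreeCodeLoop 4 ≃* FreeCodeLoop 4,
    φ '' charSubspace (normalized l) = charSubspace (normalized m)}

/-- The sizes of the orbits of the sixteen characteristic vectors. -/
def orbitSize : Fin 16 → ℕ :=
  ![1, 7, 7, 21, 28, 8, 56, 56, 168, 112, 112, 168, 56, 28, 28, 168]

/-! The squares of a code loop are given by `q(v) = |v|/4` mod 2, a function on the code that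
vanishes at `0` and has degree at most three. Its second and third differences are the exponents of
commutators and associators, so a characteristic vector is the list of coefficients of `q` in a
basis of the code.

The function `q` determines the loop. Two factor sets with the same squares have the same
commutators and associators, so their sum is a symmetric cocycle with zero diagonal. Such a cocycle
describes an elementary abelian 2-group, which splits, so it is a coboundary
(`IsCubicFactor.exists_coboundary`). Conversely, an isomorphism from a nonassociative code loop
preserves `-1`, which is a value of the associator, and hence induces a linear equivalence of the
square functions (`exists_square_eq_of_iso`). Every function of degree at most three comes from a
doubly even code, because `4xyz` is a signed sum of weights of linear forms (`exists_codeLoop`).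
Isomorphism classes of nonassociative code loops of rank 4 therefore correspond to classes under
`GL_4(2)` of functions of degree exactly three in four variables.

The third difference can be brought to the form belonging to `v_0 v_1 v_2`
(`IsCubic.exists_normalized`), which leaves 1024 choices of lower coefficients. The orbits are
classes of the same kind: the centre of the free loop is spanned by squares, so automorphisms act on
its hyperplanes as linear substitutions act on cubic functions (`exists_image_charSubspace_iff`).

What remains is finite. Elementary substitutions lead from each of the 1024 vectors to one in the
list, and `weightInvariant` separates the sixteen listed vectors. The invariant is therefore
complete, and each orbit is one of its level sets, whose size is counted. -/

/-! ### Cubic functions over the field with two elements -/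

section Cubic

set_option linter.unusedSectionVars false

variable {V A : Type*} [AddCommGroup V] [Module (ZMod 2) V] [AddCommGroup A] [Module (ZMod 2) A]

/-- The second difference of a function between vector spaces over `𝔽₂`. -/
def diffTwo (F : V → A) (u v : V) : A := F (u + v) + F u + F v

/-- The third difference of a function between vector spaces over `𝔽₂`. -/
def diffThree (F : V → A) (u v w : V) : A :=
  diffTwo F (u + v) w + diffTwo F u w + diffTwo F v w

/-- Functions of degree at most three that vanish at `0`. -/
structure IsCubic (F : V → A) : Prop where
  zero : F 0 = 0
  add : ∀ u u' v w, diffThree F (u + u') v w = diffThree F u v w + diffThree F u' v w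

theorem diffTwo_comm (F : V → A) (u v : V) : diffTwo F u v = diffTwo F v u := by
  simp only [diffTwo, add_comm u v]; abel

theorem diffTwo_self {F : V → A} (hF : F 0 = 0) (u : V) : diffTwo F u u = 0 := by
  rw [diffTwo, ZModModule.add_self, hF, zero_add, ZModModule.add_self]

theorem diffThree_comm_left (F : V → A) (u v w : V) : diffThree F u v w = diffThree F v u w := by
  simp only [diffThree, add_comm u v]; abel

theorem diffThree_comm_right (F : V → A) (u v w : V) : diffThree F u v w = diffThree F u w v := by
  have h : u + v + w = u + w + v := by abel
  simp only [diffThree, diffTwo, h, add_comm v w]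
  have h1 := ZModModule.add_self (F w)
  have h2 := ZModModule.add_self (F v)
  grind

theorem diffThree_self_left {F : V → A} (hF : F 0 = 0) (u w : V) : diffThree F u u w = 0 := by
  rw [diffThree, ZModModule.add_self, diffTwo, zero_add, hF, add_zero, ZModModule.add_self,
    zero_add, ZModModule.add_self]

theorem diffThree_self_right {F : V → A} (hF : F 0 = 0) (u w : V) : diffThree F u w w = 0 := by
  rw [diffThree_comm_left, diffThree_comm_right, diffThree_self_left hF]

theorem diffThree_self_outer {F : V → A} (hF : F 0 = 0) (u w : V) : diffThree F u w u = 0 := by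
  rw [diffThree_comm_right, diffThree_self_left hF]

theorem diffTwo_add {B : Type*} [AddCommGroup B] {F G : V → B} (u v : V) :
    diffTwo (F + G) u v = diffTwo F u v + diffTwo G u v := by
  simp only [diffTwo, Pi.add_apply]; abel

theorem diffThree_add {B : Type*} [AddCommGroup B] {F G : V → B} (u v w : V) :
    diffThree (F + G) u v w = diffThree F u v w + diffThree G u v w := by
  simp only [diffThree, diffTwo_add]; abel

theorem IsCubic.addFun {F G : V → A} (hF : IsCubic F) (hG : IsCubic G) : IsCubic (F + G) where
  zero := by rw [Pi.add_apply, hF.zero, hG.zero, add_zero]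
  add u u' v w := by simp only [diffThree_add, hF.add, hG.add]; abel

theorem IsCubic.map {B : Type*} [AddCommGroup B] [Module (ZMod 2) B] {F : V → A} (hF : IsCubic F)
    (g : A →ₗ[ZMod 2] B) : IsCubic (fun v => g (F v)) := by
  have h3 : ∀ u v w, diffThree (fun v => g (F v)) u v w = g (diffThree F u v w) := by
    intro u v w; simp [diffThree, diffTwo]
  exact ⟨by rw [hF.zero, map_zero], fun u u' v w => by rw [h3, h3, h3, hF.add, map_add]⟩

theorem IsCubic.comp {W : Type*} [AddCommGroup W] [Module (ZMod 2) W] {F : V → A} (hF : IsCubic F)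
    (g : W →ₗ[ZMod 2] V) : IsCubic (fun v => F (g v)) := by
  have h3 : ∀ u v w, diffThree (fun v => F (g v)) u v w = diffThree F (g u) (g v) (g w) := by
    intro u v w; simp [diffThree, diffTwo]
  exact ⟨by rw [map_zero, hF.zero], fun u u' v w => by rw [h3, h3, h3, map_add, hF.add]⟩

theorem eq_zero_of_additive_of_span {ι : Type*} {b : ι → V}
    (hb : Submodule.span (ZMod 2) (Set.range b) = ⊤) {f : V → A}
    (hf : ∀ u v, f (u + v) = f u + f v) (h : ∀ i, f (b i) = 0) (v : V) : f v = 0 := by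
  let g : V →ₗ[ZMod 2] A := (AddMonoidHom.mk' f hf).toZModLinearMap 2
  have hg : g = 0 := LinearMap.ext_on_range hb fun i => h i
  exact congrArg (fun k : V →ₗ[ZMod 2] A => k v) hg

/-- A cubic function is determined by its values, second differences and third differences at a
spanning family. -/
theorem IsCubic.ext_of_span {n : ℕ} {b : Fin n → V}
    (hb : Submodule.span (ZMod 2) (Set.range b) = ⊤) {F G : V → A} (hF : IsCubic F)
    (hG : IsCubic G) (h1 : ∀ i, F (b i) = G (b i))
    (h2 : ∀ i j, i < j → diffTwo F (b i) (b j) = diffTwo G (b i) (b j))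
    (h3 : ∀ i j k, i < j → j < k →
      diffThree F (b i) (b j) (b k) = diffThree G (b i) (b j) (b k)) : F = G := by
  -- Descent on the degree of `D = F + G`: the third difference is trilinear and vanishes on the
  -- family, hence is zero. Then the second difference is biadditive and vanishes for the same
  -- reason, and finally `D` itself is additive.
  have hD := hF.addFun hG
  set D := F + G with hDdef
  have d1 : ∀ i, D (b i) = 0 := fun i => by
    rw [hDdef, Pi.add_apply, h1, ZModModule.add_self]
  have d2' : ∀ i j, i < j → diffTwo D (b i) (b j) = 0 := fun i j hij => by
    rw [hDdef, diffTwo_add, h2 i j hij, ZModModule.add_self]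
  have d3' : ∀ i j k, i < j → j < k → diffThree D (b i) (b j) (b k) = 0 := fun i j k hij hjk => by
    rw [hDdef, diffThree_add, h3 i j k hij hjk, ZModModule.add_self]
  have d2 : ∀ i j, diffTwo D (b i) (b j) = 0 := fun i j => by
    rcases lt_trichotomy i j with h | rfl | h
    · exact d2' i j h
    · exact diffTwo_self hD.zero _
    · rw [diffTwo_comm]; exact d2' j i h
  have d3lt : ∀ i j k, i < j → diffThree D (b i) (b j) (b k) = 0 := fun i j k hij => by
    rcases lt_trichotomy j k with h | rfl | h
    · exact d3' i j k hij h
    · exact diffThree_self_right hD.zero _ _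
    · rw [diffThree_comm_right]
      rcases lt_trichotomy i k with h' | rfl | h'
      · exact d3' i k j h' h
      · exact diffThree_self_left hD.zero _ _
      · rw [diffThree_comm_left]; exact d3' k i j h' hij
  have d3 : ∀ i j k, diffThree D (b i) (b j) (b k) = 0 := fun i j k => by
    rcases lt_trichotomy i j with h | rfl | h
    · exact d3lt i j k h
    · exact diffThree_self_left hD.zero _ _
    · rw [diffThree_comm_left]; exact d3lt j i k h
  have e3a : ∀ j k u, diffThree D u (b j) (b k) = 0 := fun j k =>
    eq_zero_of_additive_of_span hb (fun u v => hD.add u v _ _) fun i => d3 i j k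
  have e3b : ∀ k u v, diffThree D v u (b k) = 0 := fun k u =>
    eq_zero_of_additive_of_span hb (fun v w => hD.add v w _ _) fun i => by
      rw [diffThree_comm_left]; exact e3a i k u
  have e3 : ∀ u v w, diffThree D w u v = 0 := fun u v =>
    eq_zero_of_additive_of_span hb (fun v w => hD.add v w _ _) fun i => by
      rw [diffThree_comm_left, diffThree_comm_right]; exact e3b i v u
  have a2 : ∀ w u v, diffTwo D (u + v) w = diffTwo D u w + diffTwo D v w := fun w u v => by
    have := e3 v w u
    rwa [diffThree, add_assoc, ← ZModModule.sub_eq_add, sub_eq_zero] at this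
  have e2a : ∀ j u, diffTwo D u (b j) = 0 := fun j =>
    eq_zero_of_additive_of_span hb (a2 _) fun i => d2 i j
  have e2 : ∀ v u, diffTwo D u v = 0 := fun v =>
    eq_zero_of_additive_of_span hb (a2 _) fun i => by rw [diffTwo_comm]; exact e2a i v
  have a1 : ∀ u v, D (u + v) = D u + D v := fun u v => by
    have := e2 v u
    rwa [diffTwo, add_assoc, ← ZModModule.sub_eq_add, sub_eq_zero] at this
  funext v
  have := eq_zero_of_additive_of_span hb a1 d1 v
  rwa [hDdef, Pi.add_apply, ← ZModModule.sub_eq_add, sub_eq_zero] at this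

/-! ### Factor sets -/

/-- `θ` is a factor set whose squares, commutators and associators are given by `F` and its
differences. -/
structure IsCubicFactor (F : V → A) (θ : V → V → A) : Prop where
  self : ∀ u, θ u u = F u
  comm : ∀ u v, θ u v + θ v u = diffTwo F u v
  zero_left : ∀ u, θ 0 u = 0
  zero_right : ∀ u, θ u 0 = 0
  assoc : ∀ u v w, θ (u + v) w + θ u (v + w) + θ u v + θ v w = diffThree F u v w

/-- The set `A × V`, to be endowed with the addition twisted by `τ`. -/
@[ext]
structure TwistedSum {V A : Type*} (τ : V → V → A) where
  /-- the component in the kernel -/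
  fst : A
  /-- the component in the quotient -/
  snd : V

/-- Twisting the addition of `A × V` by `τ` gives an abelian group of exponent two, that is, a
vector space over `𝔽₂`. The projection to `V` has a linear section, and its first component is `c`.
-/
theorem exists_coboundary_of_symmetric {τ : V → V → A} (self : ∀ u, τ u u = 0)
    (comm : ∀ u v, τ u v = τ v u) (zero : ∀ u, τ 0 u = 0)
    (assoc : ∀ u v w, τ u v + τ (u + v) w = τ v w + τ u (v + w)) :
    ∃ c : V → A, ∀ u v, c (u + v) = c u + c v + τ u v := by
  let _ : Add (TwistedSum τ) := ⟨fun x y => ⟨x.fst + y.fst + τ x.snd y.snd, x.snd + y.snd⟩⟩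
  let _ : Zero (TwistedSum τ) := ⟨⟨0, 0⟩⟩
  let _ : Neg (TwistedSum τ) := ⟨fun x => x⟩
  have hadd : ∀ x y : TwistedSum τ,
    x + y = ⟨x.fst + y.fst + τ x.snd y.snd, x.snd + y.snd⟩ := fun _ _ => rfl
  have hzero : (0 : TwistedSum τ) = ⟨0, 0⟩ := rfl
  have hcomm : ∀ x y : TwistedSum τ, x + y = y + x := fun x y => by
    rw [hadd, hadd, comm, add_comm x.fst, add_comm x.snd]
  have hz : ∀ x : TwistedSum τ, 0 + x = x := fun x => by
    rw [hadd, hzero]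
    ext <;> simp [zero]
  have hself : ∀ x : TwistedSum τ, x + x = 0 := fun x => by
    rw [hadd, self, ZModModule.add_self, add_zero, ZModModule.add_self, hzero]
  let _ : AddCommGroup (TwistedSum τ) :=
    { add_assoc := fun x y z => by
        simp only [hadd]
        ext
        · have := assoc x.snd y.snd z.snd
          grind
        · simp only []; abel
      zero_add := hz
      add_zero := fun x => by rw [hcomm, hz]
      neg_add_cancel := hself
      add_comm := hcomm
      nsmul := nsmulRec
      zsmul := zsmulRec }
  let _ : Module (ZMod 2) (TwistedSum τ) :=
    AddCommGroup.zmodModule fun x => by rw [two_nsmul, hself]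
  let p : TwistedSum τ →ₗ[ZMod 2] V :=
    AddMonoidHom.toZModLinearMap 2 (AddMonoidHom.mk' TwistedSum.snd fun _ _ => rfl)
  obtain ⟨s, hs⟩ := p.exists_rightInverse_of_surjective
    (LinearMap.range_eq_top.2 fun v => ⟨⟨0, v⟩, rfl⟩)
  have hs' : ∀ v, (s v).snd = v := fun v => congrArg (fun k : V →ₗ[ZMod 2] V => k v) hs
  refine ⟨fun v => (s v).fst, fun u v => ?_⟩
  simp only [map_add, hadd, hs']

/-- Two factor sets with the same squares differ by a coboundary. -/
theorem IsCubicFactor.exists_coboundary {F : V → A} {θ θ' : V → V → A} (h : IsCubicFactor F θ)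
    (h' : IsCubicFactor F θ') : ∃ c : V → A, ∀ u v, c (u + v) + θ u v = c u + c v + θ' u v := by
  -- The failures of `θ` and `θ'` to be symmetric and to satisfy the cocycle identity depend on `F`
  -- alone, so they cancel in the sum.
  obtain ⟨c, hc⟩ := exists_coboundary_of_symmetric (τ := fun u v => θ u v + θ' u v)
    (fun u => by simp only [h.self, h'.self, ZModModule.add_self])
    (fun u v => by
      have := (h.comm u v).trans (h'.comm u v).symm
      have h1 := ZModModule.add_self (θ v u)
      have h2 := ZModModule.add_self (θ' u v)
      grind)
    (fun u => by simp only [h.zero_left, h'.zero_left, add_zero])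
    (fun u v w => by
      have := (h.assoc u v w).trans (h'.assoc u v w).symm
      have h1 := ZModModule.add_self (θ u (v + w))
      have h2 := ZModModule.add_self (θ v w)
      have h3 := ZModModule.add_self (θ' (u + v) w)
      have h4 := ZModModule.add_self (θ' u v)
      grind)
  refine ⟨c, fun u v => ?_⟩
  rw [hc]
  have h1 := ZModModule.add_self (θ u v)
  grind

theorem IsCubicFactor.map {B : Type*} [AddCommGroup B] [Module (ZMod 2) B] {F : V → A}
    {θ : V → V → A} (h : IsCubicFactor F θ) (g : A →ₗ[ZMod 2] B) :
    IsCubicFactor (fun v => g (F v)) (fun u v => g (θ u v)) where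
  self u := by rw [h.self]
  comm u v := by rw [← map_add, h.comm]; simp [diffTwo]
  zero_left u := by rw [h.zero_left, map_zero]
  zero_right u := by rw [h.zero_right, map_zero]
  assoc u v w := by rw [← map_add, ← map_add, ← map_add, h.assoc]; simp [diffThree, diffTwo]

theorem IsCubicFactor.comp {W : Type*} [AddCommGroup W] [Module (ZMod 2) W] {F : V → A}
    {θ : V → V → A} (h : IsCubicFactor F θ) (g : W →ₗ[ZMod 2] V) :
    IsCubicFactor (fun v => F (g v)) (fun u v => θ (g u) (g v)) where
  self u := by rw [h.self]
  comm u v := by rw [h.comm]; simp [diffTwo]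
  zero_left u := by rw [map_zero, h.zero_left]
  zero_right u := by rw [map_zero, h.zero_right]
  assoc u v w := by rw [map_add, map_add, h.assoc]; simp [diffThree, diffTwo]

end Cubic

/-! ### The cubic functions attached to the vectors `(λ_i; λ_ij; λ_ijk)` -/

/-- The function `v ↦ v²` from `V` to the centre of the free loop. -/
def freeSquare {n : ℕ} (v : Fin n → ZMod 2) : TriVec n := freeCocycle v v

theorem isCubicFactor_freeCocycle (n : ℕ) :
    IsCubicFactor (freeSquare (n := n)) freeCocycle where
  self _ := rfl
  comm u v := by
    refine Prod.ext ?_ (Prod.ext ?_ ?_) <;> funext i <;>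
      simp only [diffTwo, freeSquare, freeCocycle, Prod.fst_add, Prod.snd_add, Pi.add_apply] <;>
      grind
  zero_left u := by
    refine Prod.ext ?_ (Prod.ext ?_ ?_) <;> funext i <;> simp [freeCocycle]
  zero_right u := by
    refine Prod.ext ?_ (Prod.ext ?_ ?_) <;> funext i <;> simp [freeCocycle]
  assoc u v w := by
    refine Prod.ext ?_ (Prod.ext ?_ ?_) <;> funext i <;>
      simp only [diffThree, diffTwo, freeSquare, freeCocycle, Prod.fst_add, Prod.snd_add,
        Pi.add_apply] <;>
      grind

theorem isCubic_freeSquare (n : ℕ) : IsCubic (freeSquare (n := n)) where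
  zero := (isCubicFactor_freeCocycle n).zero_left 0
  add u u' v w := by
    refine Prod.ext ?_ (Prod.ext ?_ ?_) <;> funext i <;>
      simp only [diffThree, diffTwo, freeSquare, freeCocycle, Prod.fst_add, Prod.snd_add,
        Pi.add_apply] <;>
      grind

/-- The function of degree at most three with the coefficients `l`. -/
def cubic {n : ℕ} (l : TriVec n) (v : Fin n → ZMod 2) : ZMod 2 := l.pair (freeSquare v)

/-- `TriVec.pair l` as a linear map. -/
def TriVec.pairHom {n : ℕ} (l : TriVec n) : TriVec n →ₗ[ZMod 2] ZMod 2 where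
  toFun := l.pair
  map_add' y z := by
    simp only [TriVec.pair, Prod.fst_add, Prod.snd_add, Pi.add_apply, mul_add,
      Finset.sum_add_distrib]
    ring
  map_smul' c z := by
    simp only [TriVec.pair, Prod.smul_fst, Prod.smul_snd, Pi.smul_apply, smul_eq_mul,
      RingHom.id_apply, mul_add, Finset.mul_sum, mul_left_comm c]

theorem isCubic_cubic {n : ℕ} (l : TriVec n) : IsCubic (cubic l) :=
  (isCubic_freeSquare n).map l.pairHom

/-- The factor set with values in `𝔽₂` obtained from `freeCocycle` by means of `l`. -/
theorem isCubicFactor_pair {n : ℕ} (l : TriVec n) :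
    IsCubicFactor (cubic l) fun u v => l.pair (freeCocycle u v) :=
  (isCubicFactor_freeCocycle n).map l.pairHom

theorem span_single_eq_top (n : ℕ) :
    Submodule.span (ZMod 2) (Set.range fun i : Fin n => (Pi.single i 1 : Fin n → ZMod 2)) = ⊤ := by
  rw [← (Pi.basisFun (ZMod 2) (Fin n)).span_eq]
  congr 2
  exact funext fun i => (Pi.basisFun_apply _ _ i).symm

/-- With the next two lemmas: the squares of the generators and their second and third differences
form the standard basis of the centre. Hence the squares span the centre. -/
theorem freeSquare_single : ∀ i : Fin 4, freeSquare (Pi.single i 1 : Fin 4 → ZMod 2) =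
    (Pi.single i 1, 0, 0) := by
  simp only [Prod.ext_iff]
  decide

theorem diffTwo_freeSquare_single : ∀ p : IncPair 4,
    diffTwo freeSquare (Pi.single p.1.1 1 : Fin 4 → ZMod 2) (Pi.single p.1.2 1) =
      (0, Pi.single p 1, 0) := by
  simp only [Prod.ext_iff]
  decide +kernel

theorem diffThree_freeSquare_single : ∀ t : IncTriple 4,
    diffThree freeSquare (Pi.single t.1.1 1 : Fin 4 → ZMod 2) (Pi.single t.1.2.1 1)
      (Pi.single t.1.2.2 1) = (0, 0, Pi.single t 1) := by
  simp only [Prod.ext_iff]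
  decide +kernel

section Lift

variable {A B : Type*} [AddCommGroup A] [Module (ZMod 2) A] [AddCommGroup B] [Module (ZMod 2) B]

/-- The linear map on the centre of the free loop with prescribed values `F v` at the `v²`. -/
def cubicLift (F : (Fin 4 → ZMod 2) → A) : TriVec 4 →ₗ[ZMod 2] A where
  toFun z := ∑ i, z.1 i • F (Pi.single i 1) +
    ∑ p, z.2.1 p • diffTwo F (Pi.single p.1.1 1) (Pi.single p.1.2 1) +
    ∑ t, z.2.2 t • diffThree F (Pi.single t.1.1 1) (Pi.single t.1.2.1 1) (Pi.single t.1.2.2 1)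
  map_add' y z := by
    simp only [Prod.fst_add, Prod.snd_add, Pi.add_apply, add_smul, Finset.sum_add_distrib]
    abel
  map_smul' c z := by
    simp only [Prod.smul_fst, Prod.smul_snd, Pi.smul_apply, smul_eq_mul, mul_smul,
      RingHom.id_apply, smul_add, Finset.smul_sum]

theorem cubicLift_single (F : (Fin 4 → ZMod 2) → A) (i : Fin 4) :
    cubicLift F (Pi.single i 1, 0, 0) = F (Pi.single i 1) := by
  simp [cubicLift, Pi.single_apply]

theorem cubicLift_pair (F : (Fin 4 → ZMod 2) → A) (p : IncPair 4) :
    cubicLift F (0, Pi.single p 1, 0) = diffTwo F (Pi.single p.1.1 1) (Pi.single p.1.2 1) := by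
  simp [cubicLift, Pi.single_apply]

theorem cubicLift_triple (F : (Fin 4 → ZMod 2) → A) (t : IncTriple 4) :
    cubicLift F (0, 0, Pi.single t 1) =
      diffThree F (Pi.single t.1.1 1) (Pi.single t.1.2.1 1) (Pi.single t.1.2.2 1) := by
  simp [cubicLift, Pi.single_apply]

theorem map_cubicLift (g : A →ₗ[ZMod 2] B) (F : (Fin 4 → ZMod 2) → A) (z : TriVec 4) :
    g (cubicLift F z) = cubicLift (fun v => g (F v)) z := by
  simp [cubicLift, map_sum, diffTwo, diffThree]

/-- Universal property of `freeSquare`: every cubic function factors through it linearly. Both sides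
are cubic and have the same data at the standard basis. -/
theorem cubicLift_freeSquare {F : (Fin 4 → ZMod 2) → A} (hF : IsCubic F) (v : Fin 4 → ZMod 2) :
    cubicLift F (freeSquare v) = F v := by
  refine congrFun (IsCubic.ext_of_span (span_single_eq_top 4)
    ((isCubic_freeSquare 4).map (cubicLift F)) hF ?_ ?_ ?_) v
  · intro i
    rw [freeSquare_single, cubicLift_single]
  · intro i j hij
    rw [← cubicLift_pair F ⟨(i, j), hij⟩, ← diffTwo_freeSquare_single ⟨(i, j), hij⟩]
    simp only [diffTwo, map_add]
  · intro i j k hij hjk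
    rw [← cubicLift_triple F ⟨(i, j, k), hij, hjk⟩,
      ← diffThree_freeSquare_single ⟨(i, j, k), hij, hjk⟩]
    simp only [diffThree, diffTwo, map_add]

theorem cubicLift_freeSquare_self (z : TriVec 4) : cubicLift freeSquare z = z := by
  have h : (cubicLift freeSquare z) = ∑ i, z.1 i • ((Pi.single i 1, 0, 0) : TriVec 4) +
      ∑ p, z.2.1 p • ((0, Pi.single p 1, 0) : TriVec 4) +
      ∑ t, z.2.2 t • ((0, 0, Pi.single t 1) : TriVec 4) := by
    simp only [← freeSquare_single, ← diffTwo_freeSquare_single, ← diffThree_freeSquare_single]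
    rfl
  rw [h]
  refine Prod.ext ?_ (Prod.ext ?_ ?_) <;> funext i <;>
    simp [Prod.fst_sum, Prod.snd_sum, Finset.sum_apply, Pi.single_apply]

/-- A linear map on the centre of the free loop is determined by its values at the `v²`. -/
theorem eq_cubicLift (g : TriVec 4 →ₗ[ZMod 2] A) (z : TriVec 4) :
    g z = cubicLift (fun v => g (freeSquare v)) z := by
  rw [← map_cubicLift, cubicLift_freeSquare_self]

end Lift

/-! ### Automorphisms of the free loop of rank four -/

namespace FreeCodeLoop

theorem mul_def {n : ℕ} (x y : FreeCodeLoop n) :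
    x * y = ⟨x.vec + y.vec, x.cen + y.cen + freeCocycle x.vec y.vec⟩ := rfl

theorem freeCocycle_zero_right {n : ℕ} (v : Fin n → ZMod 2) : freeCocycle v 0 = 0 :=
  (isCubicFactor_freeCocycle n).zero_right v

theorem mul_self {n : ℕ} (x : FreeCodeLoop n) : x * x = ⟨0, freeSquare x.vec⟩ := by
  rw [mul_def, ZModModule.add_self, ZModModule.add_self, zero_add]
  rfl

/-- Central elements are combinations of squares, and the image of a square is a square, with
trivial component in `V`. So `φ` preserves the centre and acts on the quotient. -/
theorem exists_linearEquiv (φ : FreeCodeLoop 4 ≃* FreeCodeLoop 4) :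
    ∃ g : (Fin 4 → ZMod 2) ≃ₗ[ZMod 2] (Fin 4 → ZMod 2), ∀ x, (φ x).vec = g x.vec := by
  have hmul : ∀ x y, (φ (x * y)).vec = (φ x).vec + (φ y).vec := fun x y => by
    rw [map_mul]; rfl
  let K : TriVec 4 →ₗ[ZMod 2] (Fin 4 → ZMod 2) :=
    (AddMonoidHom.mk' (fun z => (φ ⟨0, z⟩).vec) fun y z => by
      rw [← hmul, mul_def]; simp [freeCocycle_zero_right]).toZModLinearMap 2
  have hK : ∀ z, K z = 0 := fun z => by
    rw [eq_cubicLift K]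
    have : (fun v => K (freeSquare v)) = fun _ => 0 := by
      funext v
      have h := hmul ⟨v, 0⟩ ⟨v, 0⟩
      rw [ZModModule.add_self, mul_self] at h
      exact h
    rw [this]
    simp [cubicLift, diffTwo, diffThree]
  have hvec : ∀ x, (φ x).vec = (φ ⟨x.vec, 0⟩).vec := fun x => by
    have h := hmul ⟨x.vec, 0⟩ ⟨0, x.cen⟩
    have h0 : (φ ⟨0, x.cen⟩).vec = 0 := hK x.cen
    rw [h0, add_zero, mul_def] at h
    simpa [freeCocycle_zero_right] using h
  let g : (Fin 4 → ZMod 2) →ₗ[ZMod 2] (Fin 4 → ZMod 2) :=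
    (AddMonoidHom.mk' (fun v => (φ ⟨v, 0⟩).vec) fun u v => by
      rw [← hmul, hvec (_ * _)]; rfl).toZModLinearMap 2
  have hsurj : Function.Surjective g := fun v => by
    obtain ⟨x, hx⟩ := φ.surjective ⟨v, 0⟩
    exact ⟨x.vec, (hvec x).symm.trans (by rw [hx])⟩
  exact ⟨LinearEquiv.ofBijective g ⟨LinearMap.injective_iff_surjective.2 hsurj, hsurj⟩, hvec⟩

/-- The substitution `g` induces a linear map `G` of the centre with `G (v²) = (g v)²`. Transporting
the cocycle by `G` and pulling it back by `g` give factor sets with the same squares; the coboundary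
between them corrects `(g, G)` to an automorphism. -/
theorem exists_mulEquiv (g : (Fin 4 → ZMod 2) ≃ₗ[ZMod 2] (Fin 4 → ZMod 2)) :
    ∃ φ : FreeCodeLoop 4 ≃* FreeCodeLoop 4, ∀ z,
      φ ⟨0, z⟩ = ⟨0, cubicLift (fun v => freeSquare (g v)) z⟩ := by
  have hlift : ∀ g : (Fin 4 → ZMod 2) ≃ₗ[ZMod 2] (Fin 4 → ZMod 2), ∀ v,
      cubicLift (fun v => freeSquare (g v)) (freeSquare v) = freeSquare (g v) := fun g v =>
    cubicLift_freeSquare ((isCubic_freeSquare 4).comp g.toLinearMap) v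
  have hinv : ∀ g : (Fin 4 → ZMod 2) ≃ₗ[ZMod 2] (Fin 4 → ZMod 2), ∀ z,
      cubicLift (fun v => freeSquare (g.symm v)) (cubicLift (fun v => freeSquare (g v)) z) = z :=
    fun g z => by
      rw [map_cubicLift]
      simp only [hlift, LinearEquiv.symm_apply_apply, cubicLift_freeSquare_self]
  set G := cubicLift fun v => freeSquare (g v) with hG
  have h1 := (isCubicFactor_freeCocycle 4).map G
  have h2 := (isCubicFactor_freeCocycle 4).comp g.toLinearMap
  have hs : (fun v => G (freeSquare v)) = fun v => freeSquare (g.toLinearMap v) :=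
    funext (hlift g)
  rw [hs] at h1
  obtain ⟨c, hc⟩ := h1.exists_coboundary h2
  have hc0 : c 0 = 0 := by
    have := hc 0 0
    simp only [map_zero, freeCocycle_zero_right, add_zero] at this
    exact left_eq_add.1 this
  refine ⟨MulEquiv.mk'
    { toFun := fun x => ⟨g x.vec, G x.cen + c x.vec⟩
      invFun := fun x => ⟨g.symm x.vec,
        cubicLift (fun v => freeSquare (g.symm v)) (x.cen + c (g.symm x.vec))⟩
      left_inv := fun x => by
        ext1
        · simp
        · simp only [LinearEquiv.symm_apply_apply, add_assoc, ZModModule.add_self, add_zero]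
          exact hinv g _
      right_inv := fun x => by
        ext1
        · simp
        · have := hinv g.symm (x.cen + c (g.symm x.vec))
          rw [LinearEquiv.symm_symm] at this
          simp only [hG, this, add_assoc, ZModModule.add_self, add_zero] } ?_, ?_⟩
  · intro x y
    simp only [Equiv.coe_fn_mk, mul_def]
    ext1
    · exact map_add g _ _
    · simp only [map_add]
      have := hc x.vec y.vec
      simp only [LinearEquiv.coe_coe] at this
      grind
  · intro z
    change (⟨g 0, G z + c 0⟩ : FreeCodeLoop 4) = _
    rw [map_zero, hc0, add_zero]

end FreeCodeLoop

theorem ZMod.two_eq_of_eq_zero_iff : ∀ {a b : ZMod 2}, (a = 0 ↔ b = 0) → a = b := by decide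

/-- Automorphisms of the free loop act on the hyperplanes of its centre as linear substitutions
act on functions of degree at most three. -/
theorem exists_image_charSubspace_iff (l m : TriVec 4) :
    (∃ φ : FreeCodeLoop 4 ≃* FreeCodeLoop 4, φ '' charSubspace l = charSubspace m) ↔
      ∃ g : (Fin 4 → ZMod 2) ≃ₗ[ZMod 2] (Fin 4 → ZMod 2), ∀ v, cubic m (g v) = cubic l v := by
  constructor
  · rintro ⟨φ, hφ⟩
    obtain ⟨g, hg⟩ := FreeCodeLoop.exists_linearEquiv φ
    -- Over `𝔽₂` a value is known once its vanishing is, and vanishing at `v` means that `v²` lies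
    -- in the hyperplane.
    refine ⟨g, fun v => ZMod.two_eq_of_eq_zero_iff ?_⟩
    have h1 : φ ⟨0, freeSquare v⟩ = ⟨0, freeSquare (g v)⟩ := by
      rw [← FreeCodeLoop.mul_self ⟨v, 0⟩, map_mul, FreeCodeLoop.mul_self, hg]
    have h2 : φ ⟨0, freeSquare v⟩ ∈ charSubspace m ↔ ⟨0, freeSquare v⟩ ∈ charSubspace l := by
      rw [← hφ]; exact φ.injective.mem_set_image
    rw [h1] at h2
    simpa [charSubspace, cubic] using h2
  · rintro ⟨g, hg⟩
    obtain ⟨φ, hφ⟩ := FreeCodeLoop.exists_mulEquiv g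
    refine ⟨φ, ?_⟩
    -- Two linear functionals on the centre that agree at all squares are equal.
    have key : ∀ z, m.pair (cubicLift (fun v => freeSquare (g v)) z) = l.pair z := fun z => by
      have h1 := map_cubicLift m.pairHom (fun v => freeSquare (g v)) z
      have h2 := eq_cubicLift l.pairHom z
      have h3 : (fun v => m.pairHom (freeSquare (g v))) = fun v => l.pairHom (freeSquare v) :=
        funext hg
      rw [h3, ← h2] at h1
      exact h1
    obtain ⟨g', hg'⟩ := FreeCodeLoop.exists_linearEquiv φ
    ext x
    obtain ⟨y, rfl⟩ := φ.surjective x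
    rw [φ.injective.mem_set_image]
    simp only [charSubspace, Set.mem_ofPred_eq, hg', map_eq_zero_iff g' g'.injective]
    refine and_congr_right fun hy => ?_
    have hy' : y = ⟨0, y.cen⟩ := by rw [← hy]
    rw [hy', hφ, key]

theorem mem_charOrbit_iff (l m : Fin 10 → ZMod 2) :
    m ∈ charOrbit l ↔ ∃ g : (Fin 4 → ZMod 2) ≃ₗ[ZMod 2] (Fin 4 → ZMod 2),
      ∀ v, cubic (normalized m) (g v) = cubic (normalized l) v :=
  exists_image_charSubspace_iff _ _

/-! ### Linear equivalence of cubic functions -/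

/-- `F` and `G` agree up to a linear change of variables. -/
def LinEquivalent {n : ℕ} (F G : (Fin n → ZMod 2) → ZMod 2) : Prop :=
  ∃ g : (Fin n → ZMod 2) ≃ₗ[ZMod 2] (Fin n → ZMod 2), ∀ v, G (g v) = F v

namespace LinEquivalent

variable {n : ℕ} {F G H : (Fin n → ZMod 2) → ZMod 2}

theorem refl (F : (Fin n → ZMod 2) → ZMod 2) : LinEquivalent F F :=
  ⟨LinearEquiv.refl _ _, fun _ => rfl⟩

theorem symm (h : LinEquivalent F G) : LinEquivalent G F := by
  obtain ⟨g, hg⟩ := h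
  exact ⟨g.symm, fun v => by rw [← hg, g.apply_symm_apply]⟩

theorem trans (h : LinEquivalent F G) (h' : LinEquivalent G H) : LinEquivalent F H := by
  obtain ⟨g, hg⟩ := h
  obtain ⟨g', hg'⟩ := h'
  exact ⟨g.trans g', fun v => by rw [LinearEquiv.trans_apply, hg', hg]⟩

end LinEquivalent

/-- A numerical invariant of linear equivalence: it combines the number of `v` with `F v = 1` and
the number of pairs `(u, v)` with `F (u + v) + F u + F v = 1`. -/
def weightInvariant {n : ℕ} (F : (Fin n → ZMod 2) → ZMod 2) : ℕ :=
  -- For `n = 4` there are 256 pairs, and the diagonal ones contribute nothing if `F 0 = 0`, so the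
  -- two counts do not mix.
  256 * ∑ v, (F v).val + ∑ u, ∑ v, (diffTwo F u v).val

theorem LinEquivalent.weightInvariant_eq {n : ℕ} {F G : (Fin n → ZMod 2) → ZMod 2}
    (h : LinEquivalent F G) : weightInvariant F = weightInvariant G := by
  obtain ⟨g, hg⟩ := h
  unfold weightInvariant
  rw [← g.toEquiv.sum_comp (fun v => (G v).val),
    ← g.toEquiv.sum_comp (fun u => ∑ v, (diffTwo G u v).val)]
  refine congrArg₂ (fun a b => 256 * a + b) ?_ ?_
  · exact Finset.sum_congr rfl fun v _ => by rw [← hg]; rfl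
  · refine Finset.sum_congr rfl fun u _ => ?_
    rw [← g.toEquiv.sum_comp (fun v => (diffTwo G (g.toEquiv u) v).val)]
    refine Finset.sum_congr rfl fun v _ => ?_
    simp only [diffTwo, ← hg, map_add]
    rfl

theorem cubic_normalized (m : Fin 10 → ZMod 2) (v : Fin 4 → ZMod 2) :
    cubic (normalized m) v = m 0 * v 0 + m 1 * v 1 + m 2 * v 2 + m 3 * v 3 +
      m 4 * (v 0 * v 1) + m 5 * (v 0 * v 2) + m 6 * (v 0 * v 3) + m 7 * (v 1 * v 2) +
      m 8 * (v 1 * v 3) + m 9 * (v 2 * v 3) + v 0 * v 1 * v 2 := by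
  have hp : (Finset.univ : Finset (IncPair 4)) = {⟨(0, 1), by decide⟩, ⟨(0, 2), by decide⟩,
    ⟨(0, 3), by decide⟩, ⟨(1, 2), by decide⟩, ⟨(1, 3), by decide⟩, ⟨(2, 3), by decide⟩} := by decide
  have ht : (Finset.univ : Finset (IncTriple 4)) = {⟨(0, 1, 2), by decide⟩, ⟨(0, 1, 3), by decide⟩,
    ⟨(0, 2, 3), by decide⟩, ⟨(1, 2, 3), by decide⟩} := by decide
  have hsq : ∀ x : ZMod 2, x * x = x := by decide
  simp [cubic, TriVec.pair, hp, ht, normalized, freeSquare, freeCocycle, Fin.sum_univ_four, hsq]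
  grind

/-! ### Enumeration of the normalized vectors -/

/-- The element of `𝔽₂` with the given truth value. -/
def bitVal (b : Bool) : ZMod 2 := bif b then 1 else 0

theorem bitVal_xor : ∀ a b, bitVal (a ^^ b) = bitVal a + bitVal b := by decide

theorem bitVal_and : ∀ a b, bitVal (a && b) = bitVal a * bitVal b := by decide

theorem bitVal_decide_eq_one : ∀ x : ZMod 2, bitVal (decide (x = 1)) = x := by decide

theorem bitVal_injective : Function.Injective bitVal := by decide

theorem val_bitVal : ∀ b, (bitVal b).val = b.toNat := by decide

/-- The vector over `𝔽₂` of the binary digits of `c`. -/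
def digitVec (n c : ℕ) : Fin n → ZMod 2 := fun i => bitVal (c.testBit i)

theorem exists_digitVec_eq {n : ℕ} (m : Fin n → ZMod 2) : ∃ c < 2 ^ n, digitVec n c = m := by
  refine ⟨Nat.ofBits fun i => decide (m i = 1), Nat.ofBits_lt_two_pow _, funext fun i => ?_⟩
  rw [digitVec, Nat.testBit_ofBits_lt _ _ i.isLt, bitVal_decide_eq_one]

theorem digitVec_injOn (n : ℕ) : Set.InjOn (digitVec n) {c | c < 2 ^ n} := by
  intro c hc d hd h
  refine Nat.eq_of_testBit_eq fun i => ?_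
  rcases lt_or_ge i n with hi | hi
  · exact bitVal_injective (congrFun h ⟨i, hi⟩)
  · rw [Nat.testBit_lt_two_pow (lt_of_lt_of_le hc (Nat.pow_le_pow_right two_pos hi)),
      Nat.testBit_lt_two_pow (lt_of_lt_of_le hd (Nat.pow_le_pow_right two_pos hi))]

theorem digitVec_xor (n c d : ℕ) : digitVec n (c ^^^ d) = digitVec n c + digitVec n d := by
  funext i
  simp [digitVec, Nat.testBit_xor, bitVal_xor]

theorem sum_eq_sum_digitVec {n : ℕ} (h : (Fin n → ZMod 2) → ℕ) :
    ∑ v, h v = ∑ c ∈ Finset.range (2 ^ n), h (digitVec n c) := by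
  symm
  refine Finset.sum_bij (fun c _ => digitVec n c) (fun _ _ => Finset.mem_univ _) ?_ ?_
    fun _ _ => rfl
  · intro c hc d hd
    exact digitVec_injOn n (Finset.mem_range.1 hc) (Finset.mem_range.1 hd)
  · intro v _
    obtain ⟨c, hc, rfl⟩ := exists_digitVec_eq v
    exact ⟨c, Finset.mem_range.2 hc, rfl⟩

/-- The cubic function of the normalized vector with the digits of `c`. -/
def codeCubic (c : ℕ) : (Fin 4 → ZMod 2) → ZMod 2 := cubic (normalized (digitVec 10 c))

/-- The numbers whose digits are the characteristic vectors in the list. -/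
def charCodes : List ℕ := [183, 0, 176, 20, 160, 191, 8, 64, 66, 120, 72, 192, 246, 200, 201, 248]

/-- The number whose digits are those of `charVec i`. -/
def charCode (i : Fin 16) : ℕ := charCodes.getD i 0

theorem digitVec_charCode : ∀ i : Fin 16, digitVec 10 (charCode i) = charVec i := by
  decide +kernel

theorem codeCubic_charCode (i : Fin 16) :
    codeCubic (charCode i) = cubic (normalized (charVec i)) := by
  rw [codeCubic, digitVec_charCode]

theorem exists_charCode_eq : ∀ e ∈ charCodes, ∃ i, charCode i = e := by
  decide

/-! ### Elementary substitutions -/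

/-- The place of the coefficient at `v_i v_j`, or at `v_i` for `i = j`. -/
def coeffPos : Fin 4 → Fin 4 → Fin 10 :=
  ![![0, 4, 5, 6], ![4, 1, 7, 8], ![5, 7, 2, 9], ![6, 8, 9, 3]]

/-- Flip the binary digit of `c` at the place `d` if `b` holds. -/
def flipDigit (b : Bool) (d : Fin 10) (c : ℕ) : ℕ := bif b then c ^^^ 2 ^ d.val else c

theorem digitVec_flipDigit (b : Bool) (d : Fin 10) (c : ℕ) :
    digitVec 10 (flipDigit b d c) = digitVec 10 c + Pi.single d (bitVal b) := by
  cases b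
  · simp [flipDigit, bitVal]
  · simp only [flipDigit, cond_true, digitVec_xor]
    congr 1
    funext i
    simp [digitVec, Nat.testBit_two_pow, Pi.single_apply, bitVal, Fin.ext_iff, eq_comm]

/-- The effect of the substitution `v_i ↦ v_i + v_j` on the coefficients. -/
def substCode (i j : Fin 4) (c : ℕ) : ℕ :=
  -- As `v_j² = v_j`, the terms in `v_i` and `v_i v_j` both contribute to `v_j`.
  flipDigit (c.testBit (coeffPos i i) ^^ c.testBit (coeffPos i j)) (coeffPos j j) <|
  -- The term in `v_i v_k` contributes to `v_j v_k`. For `i ≠ 3` the admitted `j` lies in `{0, 1,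
  -- 2}`, and `v_0 v_1 v_2` yields an extra `v_j v_k` with `k` the third of these indices.
  [0, 1, 2, 3].foldr (fun k e => flipDigit
    (k != i && k != j && (c.testBit (coeffPos i k) ^^ (i != 3 && k != 3))) (coeffPos j k) e) c

/-- The substitutions `v_i ↦ v_i + v_j` that preserve `v_0 v_1 v_2` up to lower degree. -/
def elemSubsts : List (Fin 4 × Fin 4) :=
  [(0, 1), (0, 2), (1, 0), (1, 2), (2, 0), (2, 1), (3, 0), (3, 1), (3, 2)]

theorem codeCubic_substCode {p : Fin 4 × Fin 4} (hp : p ∈ elemSubsts) (c : ℕ)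
    (v : Fin 4 → ZMod 2) :
    codeCubic (substCode p.1 p.2 c) v = codeCubic c (v + Pi.single p.1 (v p.2)) := by
  have hsq : ∀ x : ZMod 2, x * x = x := by decide
  have h0 := hsq (v 0)
  have h1 := hsq (v 1)
  have h2 := hsq (v 2)
  have hf : bitVal false = 0 := rfl
  have hnot : ∀ b, bitVal (!b) = bitVal b + 1 := by decide
  have hd : ∀ k (hk : k < 10), bitVal (c.testBit k) = digitVec 10 c ⟨k, hk⟩ := fun _ _ => rfl
  have hd0 := hd 0 (by decide)
  have hd1 := hd 1 (by decide)
  have hd2 := hd 2 (by decide)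
  have hd3 := hd 3 (by decide)
  have hd4 := hd 4 (by decide)
  have hd5 := hd 5 (by decide)
  have hd6 := hd 6 (by decide)
  have hd7 := hd 7 (by decide)
  have hd8 := hd 8 (by decide)
  have hd9 := hd 9 (by decide)
  simp only [elemSubsts, List.mem_cons, List.not_mem_nil, or_false] at hp
  rcases hp with rfl | rfl | rfl | rfl | rfl | rfl | rfl | rfl | rfl <;>
  · simp [codeCubic, cubic_normalized, substCode, digitVec_flipDigit, coeffPos, bitVal_xor, hf,
      hnot, hd0, hd1, hd2, hd3, hd4, hd5, hd6, hd7, hd8, hd9, -Nat.testBit_zero]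
    generalize digitVec 10 c = m at *
    clear hd hd0 hd1 hd2 hd3 hd4 hd5 hd6 hd7 hd8 hd9 hf hnot hsq
    grind

theorem linEquivalent_substCode {p : Fin 4 × Fin 4} (hp : p ∈ elemSubsts) (c : ℕ) :
    LinEquivalent (codeCubic (substCode p.1 p.2 c)) (codeCubic c) := by
  have hne : p.1 ≠ p.2 := by
    revert p; decide
  let T : (Fin 4 → ZMod 2) →ₗ[ZMod 2] (Fin 4 → ZMod 2) :=
    LinearMap.id + (LinearMap.single (ZMod 2) (fun _ => ZMod 2) p.1).comp (LinearMap.proj p.2)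
  have hT : ∀ v, T v = v + Pi.single p.1 (v p.2) := fun v => rfl
  have hTT : ∀ v, T (T v) = v := fun v => by
    rw [hT, hT, Pi.add_apply, Pi.single_eq_of_ne hne.symm, add_zero, add_assoc,
      ZModModule.add_self, add_zero]
  exact ⟨LinearEquiv.ofInvolutive T hTT, fun v => (codeCubic_substCode hp c v).symm⟩

/-! ### Every normalized vector is equivalent to one in the list -/

/-- `f n`, arranged so that `n` is evaluated first. -/
def evalArg {α : Sort*} (n : ℕ) (f : ℕ → α) : α := Nat.rec (f 0) (fun k _ => f (k + 1)) n

theorem evalArg_eq {α : Sort*} (n : ℕ) (f : ℕ → α) : evalArg n f = f n := by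
  cases n <;> rfl

/-- At most `n` elementary substitutions lead from `d` to a vector in the list or to a number
smaller than `c`. -/
def reduces (c : ℕ) : ℕ → ℕ → Bool
  | 0, d => charCodes.contains d || Nat.blt d c
  | n + 1, d => reduces c n d ||
      elemSubsts.any fun p => evalArg (substCode p.1 p.2 d) (reduces c n)

theorem exists_of_reduces (c : ℕ) : ∀ n d, reduces c n d = true →
    ∃ e, (e ∈ charCodes ∨ e < c) ∧ LinEquivalent (codeCubic d) (codeCubic e)
  | 0, d, h => by
    refine ⟨d, ?_, LinEquivalent.refl _⟩
    simpa [reduces, Nat.blt_eq] using h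
  | n + 1, d, h => by
    rw [reduces, Bool.or_eq_true, List.any_eq_true] at h
    rcases h with h | ⟨p, hp, h⟩
    · exact exists_of_reduces c n d h
    · rw [evalArg_eq] at h
      obtain ⟨e, he, hde⟩ := exists_of_reduces c n _ h
      exact ⟨e, he, (linEquivalent_substCode hp d).symm.trans hde⟩

/-- A short search suffices, since it only has to lower the code when it does not reach the list;
strong induction on `c` does the rest. -/
theorem reduces_self : ((List.range 1024).all fun c => reduces c 3 c) = true := by
  decide +kernel

theorem exists_linEquivalent_charCodes (c : ℕ) (hc : c < 1024) :
    ∃ e ∈ charCodes, LinEquivalent (codeCubic c) (codeCubic e) := by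
  induction c using Nat.strong_induction_on with
  | _ c ih =>
    obtain ⟨e, he | he, h⟩ := exists_of_reduces c 3 c
      (List.all_eq_true.1 reduces_self c (List.mem_range.2 hc))
    · exact ⟨e, he, h⟩
    · obtain ⟨d, hd, h'⟩ := ih e he (he.trans hc)
      exact ⟨d, hd, h.trans h'⟩

theorem exists_linEquivalent_charVec (m : Fin 10 → ZMod 2) :
    ∃ i, LinEquivalent (cubic (normalized m)) (cubic (normalized (charVec i))) := by
  obtain ⟨c, hc, rfl⟩ := exists_digitVec_eq m
  obtain ⟨e, he, h⟩ := exists_linEquivalent_charCodes c hc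
  obtain ⟨i, rfl⟩ := exists_charCode_eq e he
  exact ⟨i, codeCubic_charCode i ▸ h⟩

/-! ### Computation of the invariant -/

/-- The binary digit of `t` at the place `k`. -/
def digitAt (t k : ℕ) : ℕ := Nat.mod (Nat.shiftRight t k) 2

theorem digitAt_eq (t k : ℕ) : digitAt t k = (t.testBit k).toNat := by
  rw [Nat.toNat_testBit, ← Nat.shiftRight_eq_div_pow]; rfl

/-- `f 0 + ⋯ + f (n - 1)`. -/
def sumUpTo (n : ℕ) (f : ℕ → ℕ) : ℕ := Nat.rec 0 (fun k s => Nat.add s (f k)) n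

theorem sumUpTo_eq (n : ℕ) (f : ℕ → ℕ) : sumUpTo n f = ∑ k ∈ Finset.range n, f k := by
  induction n with
  | zero => rfl
  | succ n ih => rw [Finset.sum_range_succ, ← ih]; rfl

/-- The monomials, each with its place and with its table of values. -/
def monomialTables : List (ℕ × ℕ) :=
  [(0, 43690), (1, 52428), (2, 61680), (3, 65280), (4, 34952), (5, 41120), (6, 43520), (7, 49344),
    (8, 52224), (9, 61440)]

/-- The number whose binary digits are the values of `codeCubic c`. -/
def valueTable (c : ℕ) : ℕ :=
  -- The initial value 32896 is the table of `v_0 v_1 v_2`, whose digits are `1` at the places 7 and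
  -- 15.
  List.rec 32896 (fun p _ t => Nat.xor t (Nat.mul (digitAt c p.1) p.2)) monomialTables

theorem testBit_xor_digitAt_mul (t c i M k : ℕ) :
    (Nat.xor t (Nat.mul (digitAt c i) M)).testBit k =
      (t.testBit k ^^ (c.testBit i && M.testBit k)) := by
  rw [digitAt_eq]
  change (t ^^^ ((c.testBit i).toNat * M)).testBit k = _
  rw [Nat.testBit_xor]
  cases c.testBit i <;> simp

theorem codeCubic_digitVec (c : ℕ) {k : ℕ} (hk : k < 16) :
    codeCubic c (digitVec 4 k) = bitVal ((valueTable c).testBit k) := by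
  have hM : ∀ k < 16, Nat.testBit 32896 k = (k.testBit 0 && k.testBit 1 && k.testBit 2) ∧
      Nat.testBit 43690 k = k.testBit 0 ∧ Nat.testBit 52428 k = k.testBit 1 ∧
      Nat.testBit 61680 k = k.testBit 2 ∧ Nat.testBit 65280 k = k.testBit 3 ∧
      Nat.testBit 34952 k = (k.testBit 0 && k.testBit 1) ∧
      Nat.testBit 41120 k = (k.testBit 0 && k.testBit 2) ∧
      Nat.testBit 43520 k = (k.testBit 0 && k.testBit 3) ∧
      Nat.testBit 49344 k = (k.testBit 1 && k.testBit 2) ∧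
      Nat.testBit 52224 k = (k.testBit 1 && k.testBit 3) ∧
      Nat.testBit 61440 k = (k.testBit 2 && k.testBit 3) := by decide +kernel
  obtain ⟨h, h0, h1, h2, h3, h4, h5, h6, h7, h8, h9⟩ := hM k hk
  simp only [codeCubic, cubic_normalized, valueTable, monomialTables, testBit_xor_digitAt_mul,
    h, h0, h1, h2, h3, h4, h5, h6, h7, h8, h9, bitVal_xor, bitVal_and]
  change bitVal (c.testBit 0) * bitVal (k.testBit 0) + bitVal (c.testBit 1) * bitVal (k.testBit 1) +
    bitVal (c.testBit 2) * bitVal (k.testBit 2) + bitVal (c.testBit 3) * bitVal (k.testBit 3) +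
    bitVal (c.testBit 4) * (bitVal (k.testBit 0) * bitVal (k.testBit 1)) +
    bitVal (c.testBit 5) * (bitVal (k.testBit 0) * bitVal (k.testBit 2)) +
    bitVal (c.testBit 6) * (bitVal (k.testBit 0) * bitVal (k.testBit 3)) +
    bitVal (c.testBit 7) * (bitVal (k.testBit 1) * bitVal (k.testBit 2)) +
    bitVal (c.testBit 8) * (bitVal (k.testBit 1) * bitVal (k.testBit 3)) +
    bitVal (c.testBit 9) * (bitVal (k.testBit 2) * bitVal (k.testBit 3)) +
    bitVal (k.testBit 0) * bitVal (k.testBit 1) * bitVal (k.testBit 2) = _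
  ring

/-- `weightInvariant` computed from the table of values. -/
def codeInvariant (c : ℕ) : ℕ :=
  evalArg (valueTable c) fun t => Nat.add
    (Nat.mul 256 (sumUpTo 16 fun k => digitAt t k))
    (sumUpTo 16 fun j => sumUpTo 16 fun k =>
      Nat.xor (Nat.xor (digitAt t (Nat.xor j k)) (digitAt t j)) (digitAt t k))

theorem weightInvariant_codeCubic (c : ℕ) : weightInvariant (codeCubic c) = codeInvariant c := by
  rw [codeInvariant, evalArg_eq, weightInvariant, sum_eq_sum_digitVec, sum_eq_sum_digitVec]
  have hx : ∀ a b, Nat.xor a b = a ^^^ b := fun _ _ => rfl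
  have h16 : 2 ^ 4 = 16 := rfl
  simp only [sumUpTo_eq, hx, Nat.add_eq, Nat.mul_eq, h16]
  refine congrArg₂ (fun a b => 256 * a + b) ?_ ?_
  · refine Finset.sum_congr rfl fun k hk => ?_
    rw [codeCubic_digitVec c (Finset.mem_range.1 hk), val_bitVal, digitAt_eq]
  · refine Finset.sum_congr rfl fun j hj => ?_
    rw [sum_eq_sum_digitVec, h16]
    refine Finset.sum_congr rfl fun k hk => ?_
    have hj' : j < 16 := Finset.mem_range.1 hj
    have hk' : k < 16 := Finset.mem_range.1 hk
    have hjk : j ^^^ k < 16 := Nat.xor_lt_two_pow (n := 4) hj' hk'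
    rw [diffTwo, ← digitVec_xor, codeCubic_digitVec c hjk, codeCubic_digitVec c hj',
      codeCubic_digitVec c hk', ← bitVal_xor, ← bitVal_xor, val_bitVal, digitAt_eq, digitAt_eq,
      digitAt_eq]
    generalize (valueTable c).testBit (j ^^^ k) = x
    generalize (valueTable c).testBit j = y
    generalize (valueTable c).testBit k = z
    revert x y z
    decide

theorem codeInvariant_charCode_injective : ∀ i j : Fin 16,
    codeInvariant (charCode i) = codeInvariant (charCode j) → i = j := by
  decide +kernel

/-- The number of `c < 1024` with the same invariant as `r`. -/
def classSize (r : ℕ) : ℕ :=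
  evalArg (codeInvariant r) fun k => sumUpTo 1024 fun c => cond (Nat.beq (codeInvariant c) k) 1 0

theorem classSize_charCode : ∀ i, classSize (charCode i) = orbitSize i := by
  decide +kernel

theorem classSize_eq (r : ℕ) : classSize r =
    {m : Fin 10 → ZMod 2 |
      weightInvariant (cubic (normalized m)) = weightInvariant (codeCubic r)}.ncard := by
  have h : {m : Fin 10 → ZMod 2 |
      weightInvariant (cubic (normalized m)) = weightInvariant (codeCubic r)} =
      digitVec 10 '' ((Finset.range 1024).filter fun c => codeInvariant c = codeInvariant r) := by
    ext m
    obtain ⟨c, hc, rfl⟩ := exists_digitVec_eq m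
    rw [(digitVec_injOn 10).mem_image_iff (s := _) (fun d hd => ?_) hc]
    · have hc' : c < 1024 := hc
      rw [Finset.mem_coe, Finset.mem_filter, Finset.mem_range, ← weightInvariant_codeCubic,
        ← weightInvariant_codeCubic]
      exact ⟨fun h => ⟨hc', h⟩, fun h => h.2⟩
    · exact Finset.mem_range.1 (Finset.mem_filter.1 hd).1
  rw [h, Set.InjOn.ncard_image, Set.ncard_coe_finset, classSize, evalArg_eq, sumUpTo_eq,
    Finset.card_filter]
  · refine Finset.sum_congr rfl fun c _ => ?_
    by_cases hcr : codeInvariant c = codeInvariant r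
    · simp [hcr]
    · rw [if_neg hcr, Bool.eq_false_iff.2 fun h' => hcr (Nat.eq_of_beq_eq_true h')]; rfl
  · exact (digitVec_injOn 10).mono fun d hd => Finset.mem_range.1 (Finset.mem_filter.1 hd).1

theorem eq_of_weightInvariant_eq {i j : Fin 16} (h : weightInvariant
    (cubic (normalized (charVec i))) = weightInvariant (cubic (normalized (charVec j)))) :
    i = j := by
  rw [← codeCubic_charCode, ← codeCubic_charCode, weightInvariant_codeCubic,
    weightInvariant_codeCubic] at h
  exact codeInvariant_charCode_injective i j h

/-- The invariant is complete: any vector is equivalent to a listed one, and the listed ones have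
distinct invariants. -/
theorem charOrbit_charVec (i : Fin 16) : charOrbit (charVec i) =
    {m | weightInvariant (cubic (normalized m)) = weightInvariant (codeCubic (charCode i))} := by
  ext m
  rw [mem_charOrbit_iff, codeCubic_charCode]
  constructor
  · intro h
    exact (LinEquivalent.weightInvariant_eq h).symm
  · intro h
    obtain ⟨j, hj⟩ := exists_linEquivalent_charVec m
    obtain rfl := eq_of_weightInvariant_eq (h.symm.trans hj.weightInvariant_eq)
    exact hj.symm

theorem ncard_charOrbit (i : Fin 16) : (charOrbit (charVec i)).ncard = orbitSize i := by
  rw [charOrbit_charVec, ← classSize_eq, classSize_charCode]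

/-! ### Weights of doubly even codes -/

theorem binWeight_eq_sum {n : ℕ} (v : Fin n → ZMod 2) : binWeight v = ∑ i, (v i).val := by
  rw [binWeight, Finset.card_filter]
  refine Finset.sum_congr rfl fun i _ => ?_
  generalize v i = x
  revert x
  decide

theorem natCast_binWeight {n : ℕ} (v : Fin n → ZMod 2) : (binWeight v : ZMod 2) = ∑ i, v i := by
  rw [binWeight_eq_sum, Nat.cast_sum]
  exact Finset.sum_congr rfl fun i _ => ZMod.natCast_zmod_val (v i)

theorem binWeight_add {n : ℕ} (u v : Fin n → ZMod 2) :
    binWeight (u + v) + 2 * binWeight (binInter u v) = binWeight u + binWeight v := by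
  have h : ∀ x y : ZMod 2, (x + y).val + 2 * (x * y).val = x.val + y.val := by decide
  simp only [binWeight_eq_sum, Finset.mul_sum, ← Finset.sum_add_distrib]
  exact Finset.sum_congr rfl fun i _ => h (u i) (v i)

theorem binInter_add {n : ℕ} (u v w : Fin n → ZMod 2) :
    binInter (u + v) w = binInter u w + binInter v w := funext fun _ => add_mul _ _ _

theorem binInter_binInter_self {n : ℕ} (u v w : Fin n → ZMod 2) :
    binInter (binInter u w) (binInter v w) = binInter (binInter u v) w := by
  have h : ∀ x y z : ZMod 2, x * z * (y * z) = x * y * z := by decide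
  exact funext fun i => h (u i) (v i) (w i)

section Weight

variable {n : ℕ} {V : Submodule (ZMod 2) (Fin n → ZMod 2)}

/-- The function `v ↦ |v| / 4` modulo two. -/
def quarterWeight (v : V) : ZMod 2 := (binWeight (v : Fin n → ZMod 2) / 4 : ℕ)

/-- Divide `|u + v| + 2|u ∩ v| = |u| + |v|` by four and reduce modulo two. -/
theorem diffTwo_quarterWeight (hV : IsDoublyEven V) (u v : V) : diffTwo quarterWeight u v =
    (binWeight (binInter (u : Fin n → ZMod 2) v) / 2 : ℕ) := by
  obtain ⟨a, ha⟩ := hV.weight u u.2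
  obtain ⟨b, hb⟩ := hV.weight v v.2
  obtain ⟨c, hc⟩ := hV.weight (u + v) (u + v).2
  obtain ⟨d, hd⟩ := hV.inter u u.2 v v.2
  have h := binWeight_add (u : Fin n → ZMod 2) v
  have h' : c + d = a + b := by omega
  have h'' : (c : ZMod 2) + d = a + b := by
    rw [← Nat.cast_add, ← Nat.cast_add, h']
  simp only [diffTwo, quarterWeight, Submodule.coe_add, ha, hb, hc, hd,
    Nat.mul_div_cancel_left _ (show 0 < 4 by decide),
    Nat.mul_div_cancel_left _ (show 0 < 2 by decide)]
  grind

/-- The same identity for `u ∩ w` and `v ∩ w`, now divided by two. The resulting parity of `|u ∩ v ∩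
w|` is trilinear, so `quarterWeight` is cubic. -/
theorem diffThree_quarterWeight (hV : IsDoublyEven V) (u v w : V) :
    diffThree quarterWeight u v w =
      binWeight (binInter (binInter (u : Fin n → ZMod 2) v) w) := by
  obtain ⟨a, ha⟩ := hV.inter u u.2 w w.2
  obtain ⟨b, hb⟩ := hV.inter v v.2 w w.2
  obtain ⟨c, hc⟩ := hV.inter (u + v) (u + v).2 w w.2
  have h := binWeight_add (binInter (u : Fin n → ZMod 2) w) (binInter v w)
  rw [← binInter_add, binInter_binInter_self, ha, hb, hc] at h
  have h' : c + binWeight (binInter (binInter (u : Fin n → ZMod 2) v) w) = a + b := by omega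
  have h'' : (c : ZMod 2) + binWeight (binInter (binInter (u : Fin n → ZMod 2) v) w) = a + b := by
    rw [← Nat.cast_add, ← Nat.cast_add, h']
  simp only [diffThree, diffTwo_quarterWeight hV, Submodule.coe_add, ha, hb, hc,
    Nat.mul_div_cancel_left _ (show 0 < 2 by decide)]
  grind

theorem isCubic_quarterWeight (hV : IsDoublyEven V) : IsCubic (quarterWeight (V := V)) where
  zero := by simp [quarterWeight, binWeight]
  add u u' v w := by
    simp only [diffThree_quarterWeight hV, natCast_binWeight, ← Finset.sum_add_distrib]
    exact Finset.sum_congr rfl fun i _ => by simp [binInter, add_mul]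

end Weight

/-! ### Signs -/

/-- The sign `(-1)^a`. -/
def signOf (a : ZMod 2) : ℤˣ := (-1) ^ a.val

/-- The exponent `a` of the sign `(-1)^a`. -/
def signExp (s : ℤˣ) : ZMod 2 := if s = 1 then 0 else 1

theorem signOf_add : ∀ a b, signOf (a + b) = signOf a * signOf b := by decide

theorem signOf_natCast (k : ℕ) : signOf k = (-1) ^ k := by
  rw [signOf, ZMod.val_natCast]
  conv_rhs => rw [← Nat.div_add_mod k 2, pow_add, pow_mul]
  simp

theorem signOf_signExp : ∀ s, signOf (signExp s) = s := by decide

theorem signExp_signOf : ∀ a, signExp (signOf a) = a := by decide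

theorem signExp_mul : ∀ s t, signExp (s * t) = signExp s + signExp t := by decide

theorem signExp_injective : Function.Injective signExp := by decide

theorem signExp_neg_one_pow (k : ℕ) : signExp ((-1) ^ k) = k := by
  rw [← signOf_natCast, signExp_signOf]

theorem isCubicFactor_of_isFactorSet {n : ℕ} {V : Submodule (ZMod 2) (Fin n → ZMod 2)}
    (hV : IsDoublyEven V) {φ : V → V → ℤˣ} (h : IsFactorSet V φ) :
    IsCubicFactor quarterWeight fun u v => signExp (φ u v) where
  self u := by rw [h.self, signExp_neg_one_pow]; rfl
  comm u v := by
    rw [h.comm, signExp_mul, signExp_neg_one_pow, diffTwo_quarterWeight hV, add_assoc,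
      ZModModule.add_self, add_zero]
  zero_left u := by rw [h.zero_left]; rfl
  zero_right u := by rw [h.zero_right]; rfl
  assoc u v w := by
    rw [h.assoc, signExp_mul, signExp_mul, signExp_mul, signExp_neg_one_pow,
      diffThree_quarterWeight hV]
    grind

theorem isFactorSet_of_isCubicFactor {n : ℕ} {V : Submodule (ZMod 2) (Fin n → ZMod 2)}
    (hV : IsDoublyEven V) {θ : V → V → ZMod 2} (h : IsCubicFactor quarterWeight θ) :
    IsFactorSet V fun u v => signOf (θ u v) where
  self u := by rw [h.self, quarterWeight, signOf_natCast]
  comm u v := by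
    rw [← signOf_natCast, ← diffTwo_quarterWeight hV, ← h.comm, ← signOf_add]
    congr 1
    grind
  zero_left u := by rw [h.zero_left]; rfl
  zero_right u := by rw [h.zero_right]; rfl
  assoc u v w := by
    rw [← signOf_natCast, ← diffThree_quarterWeight hV, ← h.assoc, ← signOf_add, ← signOf_add,
      ← signOf_add]
    congr 1
    grind

/-! ### Code loops and cubic functions -/

namespace CodeLoop

variable {L M : CodeLoop}

/-- The cubic function `v ↦ |v| / 4` on the code of a code loop; it gives the squares. -/
def square (L : CodeLoop) : L.code → ZMod 2 := quarterWeight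

theorem isCubic_square (L : CodeLoop) : IsCubic L.square := isCubic_quarterWeight L.doublyEven

theorem isCubicFactor (L : CodeLoop) :
    IsCubicFactor L.square fun u v => signExp (L.factor u v) :=
  isCubicFactor_of_isFactorSet L.doublyEven L.isFactorSet

theorem sign_mul (x y : L.Carrier) :
    (x * y).sign = x.sign * y.sign * L.factor x.word y.word := rfl

theorem word_mul (x y : L.Carrier) : (x * y).word = x.word + y.word := rfl

theorem eq_iff (x y : L.Carrier) :
    x = y ↔ signExp x.sign = signExp y.sign ∧ x.word = y.word := by
  rw [Carrier.ext_iff, signExp_injective.eq_iff]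

theorem signExp_sign_signElt (a : ZMod 2) : signExp (L.signElt a).sign = a := signExp_signOf a

theorem word_signElt (a : ZMod 2) : (L.signElt a).word = 0 := rfl

theorem mul_self_eq_signElt_iff (x : L.Carrier) (a : ZMod 2) :
    x * x = L.signElt a ↔ L.square x.word = a := by
  rw [eq_iff, sign_mul, word_mul, signExp_sign_signElt, word_signElt, signExp_mul, signExp_mul,
    L.isCubicFactor.self, ZModModule.add_self, ZModModule.add_self, zero_add]
  exact and_iff_left rfl

theorem mul_eq_mul_signElt_iff (x y : L.Carrier) (a : ZMod 2) :
    x * y = (y * x) * L.signElt a ↔ diffTwo L.square x.word y.word = a := by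
  have hz := L.isCubicFactor.zero_right (x.word + y.word)
  have hc := L.isCubicFactor.comm x.word y.word
  simp only [eq_iff, sign_mul, word_mul, signExp_sign_signElt, word_signElt, signExp_mul,
    ← hc, add_comm y.word x.word, add_zero, and_true]
  grind

theorem mul_assoc_signElt_iff (x y z : L.Carrier) (a : ZMod 2) :
    (x * y) * z = L.signElt a * (x * (y * z)) ↔
      diffThree L.square x.word y.word z.word = a := by
  have hz := L.isCubicFactor.zero_left (x.word + (y.word + z.word))
  have hc := L.isCubicFactor.assoc x.word y.word z.word
  simp only [eq_iff, sign_mul, word_mul, signExp_sign_signElt, word_signElt, signExp_mul, hz,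
    ← hc, add_assoc, zero_add, add_zero, and_true]
  grind

theorem signElt_zero_mul (x : L.Carrier) : L.signElt 0 * x = x := by
  have hz := L.isCubicFactor.zero_left x.word
  rw [eq_iff, sign_mul, word_mul, signExp_mul, signExp_mul, signExp_sign_signElt, word_signElt, hz,
    zero_add, zero_add, add_zero]
  exact ⟨rfl, rfl⟩

theorem signElt_mul (a : ZMod 2) (x : L.Carrier) : L.signElt a * x = ⟨signOf a * x.sign, x.word⟩ := by
  have hz := L.isCubicFactor.zero_left x.word
  rw [eq_iff, sign_mul, word_mul, signExp_mul, signExp_mul, word_signElt, hz, zero_add, add_zero,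
    ← signExp_mul]
  exact ⟨rfl, rfl⟩

theorem nonassociative_iff :
    L.Nonassociative ↔ ∃ u v w, diffThree L.square u v w = 1 := by
  have key : ∀ x y z : L.Carrier, x * y * z ≠ x * (y * z) ↔
      diffThree L.square x.word y.word z.word = 1 := fun x y z => by
    have h := mul_assoc_signElt_iff x y z 0
    rw [signElt_zero_mul] at h
    rw [ne_eq, h]
    generalize diffThree L.square x.word y.word z.word = a
    revert a
    decide
  constructor
  · rintro ⟨x, y, z, h⟩
    exact ⟨_, _, _, (key x y z).1 h⟩
  · rintro ⟨u, v, w, h⟩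
    exact ⟨⟨1, u⟩, ⟨1, v⟩, ⟨1, w⟩, (key _ _ _).2 h⟩

/-- Code loops with linearly equivalent square functions are isomorphic. -/
theorem iso_of_square_eq (g : L.code ≃ₗ[ZMod 2] M.code)
    (hg : ∀ v, M.square (g v) = L.square v) : L.Iso M := by
  have h2 := M.isCubicFactor.comp g.toLinearMap
  have hs : (fun v => M.square (g.toLinearMap v)) = L.square := funext hg
  rw [hs] at h2
  obtain ⟨c, hc⟩ := L.isCubicFactor.exists_coboundary h2
  refine ⟨MulEquiv.mk'
    { toFun := fun x => ⟨x.sign * signOf (c x.word), g x.word⟩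
      invFun := fun y => ⟨y.sign * signOf (c (g.symm y.word)), g.symm y.word⟩
      left_inv := fun x => by simp [mul_assoc]
      right_inv := fun y => by simp [mul_assoc] } fun x y => ?_⟩
  rw [eq_iff]
  refine ⟨?_, map_add g _ _⟩
  have := hc x.word y.word
  simp only [Equiv.coe_fn_mk, sign_mul, word_mul, signExp_mul, signExp_signOf,
    LinearEquiv.coe_coe] at this ⊢
  grind

/-- An isomorphism of code loops that fixes the sign induces a linear equivalence of the square
functions. The sign is fixed as soon as it is an associator. -/
theorem exists_square_eq_of_iso (hL : L.Nonassociative) (h : L.Iso M) :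
    ∃ g : L.code ≃ₗ[ZMod 2] M.code, ∀ v, M.square (g v) = L.square v := by
  obtain ⟨φ⟩ := h
  -- The image of the identity is idempotent, so its word is zero; an element over the zero word
  -- squares to the identity.
  have hone : φ (L.signElt 0) = M.signElt 0 := by
    have h1 : φ (L.signElt 0) * φ (L.signElt 0) = φ (L.signElt 0) := by
      rw [← map_mul, signElt_zero_mul]
    have hw : (φ (L.signElt 0)).word = 0 := by
      simpa [word_mul] using congrArg Carrier.word h1
    rw [← h1, mul_self_eq_signElt_iff, hw, M.isCubic_square.zero]
  -- Here nonassociativity enters: `-1` is an associator, and comparing words in the image of that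
  -- relation shows that `φ (-1)` lies over the zero word. Injectivity leaves only `-1`.
  have hneg : φ (L.signElt 1) = M.signElt 1 := by
    obtain ⟨u, v, w, h⟩ := nonassociative_iff.1 hL
    have h1 := (mul_assoc_signElt_iff (⟨1, u⟩ : L.Carrier) ⟨1, v⟩ ⟨1, w⟩ 1).2 h
    have h2 := congrArg φ h1
    simp only [map_mul] at h2
    have hw : (φ (L.signElt 1)).word = 0 := by
      have := congrArg Carrier.word h2
      simp only [word_mul, add_assoc] at this
      exact right_eq_add.1 this
    have hne : φ (L.signElt 1) ≠ M.signElt 0 := fun h => by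
      rw [← hone] at h
      have := congrArg (fun x => signExp x.sign) (φ.injective h)
      simp [signExp_sign_signElt] at this
    rw [ne_eq, eq_iff, hw, signExp_sign_signElt] at hne
    rw [eq_iff, hw, signExp_sign_signElt]
    refine ⟨?_, rfl⟩
    have : ∀ a : ZMod 2, ¬(a = 0 ∧ True) → a = 1 := by decide
    exact this _ fun h => hne ⟨h.1, rfl⟩
  have hsign : ∀ a, φ (L.signElt a) = M.signElt a := fun a => by
    have : a = 0 ∨ a = 1 := by revert a; decide
    rcases this with rfl | rfl
    exacts [hone, hneg]
  have hword : ∀ x, (φ x).word = (φ ⟨1, x.word⟩).word := fun x => by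
    have : x = L.signElt (signExp x.sign) * ⟨1, x.word⟩ := by
      rw [signElt_mul, signOf_signExp, mul_one]
    conv_lhs => rw [this, map_mul, hsign, word_mul, word_signElt, zero_add]
  let g : L.code →ₗ[ZMod 2] M.code :=
    (AddMonoidHom.mk' (fun v => (φ ⟨1, v⟩).word) fun u v => by
      rw [← word_mul, ← map_mul, hword (_ * _)]; rfl).toZModLinearMap 2
  have hg : ∀ x, (φ x).word = g x.word := hword
  have hinj : Function.Injective g := by
    refine (injective_iff_map_eq_zero g).2 fun v hv => ?_
    have h1 : φ ⟨1, v⟩ = φ (L.signElt (signExp (φ ⟨1, v⟩).sign)) := by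
      rw [hsign, eq_iff, signExp_sign_signElt]
      exact ⟨rfl, hv⟩
    exact congrArg Carrier.word (φ.injective h1)
  have hsurj : Function.Surjective g := fun w => by
    obtain ⟨x, hx⟩ := φ.surjective ⟨1, w⟩
    exact ⟨x.word, by rw [← hg, hx]⟩
  refine ⟨LinearEquiv.ofBijective g ⟨hinj, hsurj⟩, fun v => ?_⟩
  have h1 := (mul_self_eq_signElt_iff (⟨1, v⟩ : L.Carrier) _).2 rfl
  have h2 := congrArg φ h1
  rw [map_mul, hsign, mul_self_eq_signElt_iff, hg] at h2
  exact h2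

end CodeLoop

/-! ### Characteristic vectors and bases -/

theorem cubic_single (l : TriVec 4) (i : Fin 4) : cubic l (Pi.single i 1) = l.1 i := by
  rw [cubic, freeSquare_single]
  simp [TriVec.pair, Pi.single_apply]

theorem diffTwo_cubic_single (l : TriVec 4) (p : IncPair 4) :
    diffTwo (cubic l) (Pi.single p.1.1 1) (Pi.single p.1.2 1) = l.2.1 p := by
  have h := congrArg l.pairHom (diffTwo_freeSquare_single p)
  simp only [diffTwo, map_add] at h
  refine h.trans ?_
  simp [TriVec.pairHom, TriVec.pair, Pi.single_apply]

theorem diffThree_cubic_single (l : TriVec 4) (t : IncTriple 4) :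
    diffThree (cubic l) (Pi.single t.1.1 1) (Pi.single t.1.2.1 1) (Pi.single t.1.2.2 1) =
      l.2.2 t := by
  have h := congrArg l.pairHom (diffThree_freeSquare_single t)
  simp only [diffThree, diffTwo, map_add] at h
  refine h.trans ?_
  simp [TriVec.pairHom, TriVec.pair, Pi.single_apply]

/-- A function of degree at most three is determined by its coefficients. -/
theorem IsCubic.comp_eq_cubic {V : Type*} [AddCommGroup V] [Module (ZMod 2) V] {F : V → ZMod 2}
    (hF : IsCubic F) (e : (Fin 4 → ZMod 2) ≃ₗ[ZMod 2] V) {l : TriVec 4}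
    (h1 : ∀ i, F (e (Pi.single i 1)) = l.1 i)
    (h2 : ∀ p : IncPair 4,
      diffTwo F (e (Pi.single p.1.1 1)) (e (Pi.single p.1.2 1)) = l.2.1 p)
    (h3 : ∀ t : IncTriple 4, diffThree F (e (Pi.single t.1.1 1)) (e (Pi.single t.1.2.1 1))
      (e (Pi.single t.1.2.2 1)) = l.2.2 t) (v : Fin 4 → ZMod 2) : F (e v) = cubic l v := by
  refine congrFun (IsCubic.ext_of_span (span_single_eq_top 4) (hF.comp e.toLinearMap)
    (isCubic_cubic l) ?_ ?_ ?_) v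
  · intro i
    rw [cubic_single]
    exact h1 i
  · intro i j hij
    rw [diffTwo_cubic_single l ⟨(i, j), hij⟩, ← h2]
    simp [diffTwo]
  · intro i j k hij hjk
    rw [diffThree_cubic_single l ⟨(i, j, k), hij, hjk⟩, ← h3]
    simp [diffThree, diffTwo]

namespace CodeLoop

variable {L M : CodeLoop}

theorem IsCharVector.span_eq_top {n : ℕ} {x : Fin n → L.Carrier} {l : TriVec n}
    (h : L.IsCharVector x l) :
    Submodule.span (ZMod 2) (Set.range fun i => (x i).word) = ⊤ := by
  rw [eq_top_iff]
  intro v _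
  have hv : (⟨1, v⟩ : L.Carrier) ∈ Subsemigroup.closure (Set.range x) := by
    rw [h.generates]; trivial
  refine Subsemigroup.closure_induction
    (p := fun y _ => y.word ∈ Submodule.span (ZMod 2) (Set.range fun i => (x i).word)) ?_ ?_ hv
  · rintro _ ⟨i, rfl⟩
    exact Submodule.subset_span ⟨i, rfl⟩
  · intro y z _ _ hy hz
    exact Submodule.add_mem _ hy hz

/-- The words of four generators span a space of dimension four, so they form a basis; in it the
entries of `l` are the coefficients of the square function. -/
theorem IsCharVector.exists_linearEquiv {x : Fin 4 → L.Carrier} {l : TriVec 4}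
    (h : L.IsCharVector x l) (hL : L.rank = 4) :
    ∃ e : (Fin 4 → ZMod 2) ≃ₗ[ZMod 2] L.code, ∀ v, L.square (e v) = cubic l v := by
  let b := basisOfTopLeSpanOfCardEqFinrank (fun i => (x i).word) h.span_eq_top.ge
    (by rw [Fintype.card_fin]; exact hL.symm)
  have hb : ∀ i, b.equivFun.symm (Pi.single i 1) = (x i).word := fun i => by
    simp [b, Module.Basis.equivFun_symm_apply, Pi.single_apply]
  refine ⟨b.equivFun.symm, L.isCubic_square.comp_eq_cubic _ ?_ ?_ ?_⟩
  · intro i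
    rw [hb]
    exact (mul_self_eq_signElt_iff _ _).1 (h.square i)
  · intro p
    rw [hb, hb]
    exact (mul_eq_mul_signElt_iff _ _ _).1 (h.commutator p)
  · intro t
    rw [hb, hb, hb]
    exact (mul_assoc_signElt_iff _ _ _ _).1 (h.associator t)

/-- The generated subloop meets the fibre over every word. The nontrivial associator puts two
products `p = -q` into it, so `y p` and `y q` exhaust the fibre over their common word. -/
theorem closure_eq_top {n : ℕ} {x : Fin n → L.Carrier}
    (hx : Submodule.span (ZMod 2) (Set.range fun i => (x i).word) = ⊤) {i j k : Fin n}
    (h : diffThree L.square (x i).word (x j).word (x k).word = 1) :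
    Subsemigroup.closure (Set.range x) = ⊤ := by
  set S := Subsemigroup.closure (Set.range x)
  have hmem : ∀ i, x i ∈ S := fun i => Subsemigroup.subset_closure ⟨i, rfl⟩
  have hword : ∀ v : L.code, ∃ y ∈ S, y.word = v := fun v => by
    have hv : v ∈ Submodule.span (ZMod 2) (Set.range fun i => (x i).word) := hx ▸ trivial
    have h0 : ∃ y ∈ S, y.word = 0 :=
      ⟨x i * x i, S.mul_mem (hmem i) (hmem i), ZModModule.add_self _⟩
    induction hv using Submodule.span_induction with
    | mem v hv =>
      obtain ⟨i, rfl⟩ := hv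
      exact ⟨x i, hmem i, rfl⟩
    | zero => exact h0
    | add u v _ _ hu hv =>
      obtain ⟨y, hy, rfl⟩ := hu
      obtain ⟨z, hz, rfl⟩ := hv
      exact ⟨y * z, S.mul_mem hy hz, rfl⟩
    | smul c v _ hv =>
      have : c = 0 ∨ c = 1 := by revert c; decide
      rcases this with rfl | rfl
      · rwa [zero_smul]
      · rwa [one_smul]
  have hp : (x i * x j) * x k ∈ S := S.mul_mem (S.mul_mem (hmem i) (hmem j)) (hmem k)
  have hq : x i * (x j * x k) ∈ S := S.mul_mem (hmem i) (S.mul_mem (hmem j) (hmem k))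
  have hpq := (mul_assoc_signElt_iff (x i) (x j) (x k) 1).2 h
  rw [signElt_mul] at hpq
  set p := (x i * x j) * x k
  set q := x i * (x j * x k)
  rw [eq_top_iff]
  rintro z -
  obtain ⟨y, hy, hyw⟩ := hword (z.word + q.word)
  have hyp := S.mul_mem hy hp
  have hyq := S.mul_mem hy hq
  have hzw : (y * q).word = z.word := by
    rw [word_mul, hyw, add_assoc, ZModModule.add_self, add_zero]
  have hs : (y * p).sign = - (y * q).sign := by
    rw [hpq]
    simp [sign_mul, signOf, ZMod.val_one]
  have hzw' : (y * p).word = z.word := by rw [hpq]; exact hzw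
  have hcase : ∀ s t : ℤˣ, s = t ∨ s = -t := by decide
  rcases hcase z.sign (y * q).sign with h | h
  · have : z = y * q := Carrier.ext h hzw.symm
    rwa [this]
  · have : z = y * p := Carrier.ext (h.trans hs.symm) hzw'.symm
    rwa [this]

theorem exists_isCharVector (m : Fin 10 → ZMod 2) (e : (Fin 4 → ZMod 2) ≃ₗ[ZMod 2] L.code)
    (he : ∀ v, L.square (e v) = cubic (normalized m) v) :
    ∃ x, L.IsCharVector x (normalized m) := by
  have h2 : ∀ p : IncPair 4, diffTwo L.square (e (Pi.single p.1.1 1)) (e (Pi.single p.1.2 1)) =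
      (normalized m).2.1 p := fun p => by
    rw [← diffTwo_cubic_single]
    simp only [diffTwo, ← map_add, he]
  have h3 : ∀ t : IncTriple 4, diffThree L.square (e (Pi.single t.1.1 1))
      (e (Pi.single t.1.2.1 1)) (e (Pi.single t.1.2.2 1)) = (normalized m).2.2 t := fun t => by
    rw [← diffThree_cubic_single]
    simp only [diffThree, diffTwo, ← map_add, he]
  refine ⟨fun i => ⟨1, e (Pi.single i 1)⟩, ?_, ?_, ?_, ?_⟩
  · refine closure_eq_top (i := 0) (j := 1) (k := 2) ?_ ((h3 ⟨(0, 1, 2), by decide⟩).trans ?_)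
    · have h := congrArg (Submodule.map e.toLinearMap) (span_single_eq_top 4)
      rw [Submodule.map_span, Submodule.map_top, LinearEquiv.range, ← Set.range_comp] at h
      exact h
    · simp [normalized]
  · intro i
    rw [mul_self_eq_signElt_iff, he, cubic_single]
  · intro p
    exact (mul_eq_mul_signElt_iff _ _ _).2 (h2 p)
  · intro t
    exact (mul_assoc_signElt_iff _ _ _ _).2 (h3 t)

end CodeLoop

/-! ### Normalization -/

section Normalization

variable {V : Type*} [AddCommGroup V] [Module (ZMod 2) V]

theorem IsCubic.diffThree_smul_add {F : V → ZMod 2} (hF : IsCubic F) (a b c : ZMod 2)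
    (x y z u v : V) : diffThree F (a • x + b • y + c • z) u v =
      a * diffThree F x u v + b * diffThree F y u v + c * diffThree F z u v := by
  let g : V →ₗ[ZMod 2] ZMod 2 :=
    (AddMonoidHom.mk' (fun w => diffThree F w u v) fun _ _ => hF.add _ _ _ _).toZModLinearMap 2
  change g _ = a * g x + b * g y + c * g z
  simp

/-- A function of degree three in four variables has degree three with leading part `v_0 v_1 v_2`
in suitable coordinates. -/
theorem IsCubic.exists_normalized {F : V → ZMod 2} (hF : IsCubic F)
    (hV : Module.finrank (ZMod 2) V = 4) {x y z : V} (h : diffThree F x y z = 1) :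
    ∃ (e : (Fin 4 → ZMod 2) ≃ₗ[ZMod 2] V) (m : Fin 10 → ZMod 2),
      ∀ v, F (e v) = cubic (normalized m) v := by
  have hswap : diffThree F y x z = 1 := by rw [diffThree_comm_left, h]
  have hrot : diffThree F z x y = 1 := by rw [diffThree_comm_left, diffThree_comm_right, h]
  have h0 := hF.zero
  obtain ⟨t, ht⟩ : ∃ t, t ∉ Submodule.span (ZMod 2) (Set.range ![x, y, z]) := by
    by_contra! hall
    have htop : Submodule.span (ZMod 2) (Set.range ![x, y, z]) = ⊤ := eq_top_iff.2 fun v _ => hall v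
    have hle := finrank_range_le_card (R := ZMod 2) ![x, y, z]
    rw [Set.finrank, htop, finrank_top, hV] at hle
    simp at hle
  -- The coefficients make the third differences of `w` with two of `x, y, z` vanish: each added
  -- vector cancels exactly one of those of `t`.
  set w := (diffThree F t y z • x + diffThree F t x z • y + diffThree F t x y • z) + t with hw
  have hmem : ∀ a b c : ZMod 2, a • x + b • y + c • z ∈
      Submodule.span (ZMod 2) (Set.range ![x, y, z]) := fun a b c => by
    refine Submodule.add_mem _ (Submodule.add_mem _ ?_ ?_) ?_ <;>
      refine Submodule.smul_mem _ _ (Submodule.subset_span ?_)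
    exacts [⟨0, rfl⟩, ⟨1, rfl⟩, ⟨2, rfl⟩]
  have hwn : w ∉ Submodule.span (ZMod 2) (Set.range ![x, y, z]) := fun hmw =>
    ht ((Submodule.add_mem_iff_right _ (hmem _ _ _)).1 hmw)
  have hwyz : diffThree F w y z = 0 := by
    rw [hw, hF.add, hF.diffThree_smul_add, h, diffThree_self_left h0, diffThree_self_outer h0]
    grind
  have hwxz : diffThree F w x z = 0 := by
    rw [hw, hF.add, hF.diffThree_smul_add, hswap, diffThree_self_left h0, diffThree_self_outer h0]
    grind
  have hwxy : diffThree F w x y = 0 := by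
    rw [hw, hF.add, hF.diffThree_smul_add, hrot, diffThree_self_left h0, diffThree_self_outer h0]
    grind
  have hli : LinearIndependent (ZMod 2) ![x, y, z, w] := by
    rw [Fintype.linearIndependent_iff]
    intro g hg
    simp only [Fin.sum_univ_four, Matrix.cons_val_zero, Matrix.cons_val_one, Matrix.cons_val] at hg
    have hg3 : g 3 = 0 := by
      by_contra hne
      have h1 : g 3 = 1 := by
        have : ∀ a : ZMod 2, a ≠ 0 → a = 1 := by decide
        exact this _ hne
      rw [h1, one_smul, ← ZModModule.sub_eq_add, sub_eq_zero] at hg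
      exact hwn (hg ▸ hmem _ _ _)
    rw [hg3, zero_smul, add_zero] at hg
    -- Pairing a relation among `x, y, z` with `(y, z)`, `(x, z)` and `(x, y)` isolates its
    -- coefficients.
    have e0 := hF.diffThree_smul_add (g 0) (g 1) (g 2) x y z y z
    have e1 := hF.diffThree_smul_add (g 0) (g 1) (g 2) x y z x z
    have e2 := hF.diffThree_smul_add (g 0) (g 1) (g 2) x y z x y
    have hz : ∀ u v, diffThree F 0 u v = 0 := fun u v => by
      have := hF.add 0 0 u v
      rw [add_zero] at this
      exact left_eq_add.1 this
    simp only [hg, hz, h, hswap, hrot, diffThree_self_left h0, diffThree_self_outer h0, mul_zero,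
      mul_one, add_zero, zero_add] at e0 e1 e2
    intro i
    fin_cases i
    exacts [e0.symm, e1.symm, e2.symm, hg3]
  let b := basisOfLinearIndependentOfCardEqFinrank hli (by rw [Fintype.card_fin, hV])
  have hb : ∀ i, b.equivFun.symm (Pi.single i 1) = ![x, y, z, w] i := fun i => by
    simp [b, Module.Basis.equivFun_symm_apply, Pi.single_apply]
  refine ⟨b.equivFun.symm, ![F x, F y, F z, F w, diffTwo F x y, diffTwo F x z, diffTwo F x w,
    diffTwo F y z, diffTwo F y w, diffTwo F z w], hF.comp_eq_cubic _ ?_ ?_ ?_⟩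
  · intro i
    rw [hb]
    fin_cases i <;> rfl
  · rintro ⟨⟨i, j⟩, hij⟩
    simp only [hb]
    fin_cases i <;> fin_cases j <;> first | rfl | exact absurd hij (by decide)
  · have hperm : ∀ u v, diffThree F u v w = diffThree F w u v := fun u v => by
      rw [diffThree_comm_right, diffThree_comm_left]
    have ht : ∀ t : IncTriple 4, t.1 = (0, 1, 2) ∨ t.1 = (0, 1, 3) ∨ t.1 = (0, 2, 3) ∨
      t.1 = (1, 2, 3) := by decide
    intro t
    simp only [hb, normalized]
    rcases ht t with h' | h' | h' | h' <;> rw [h']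
    · exact h
    · exact (hperm x y).trans hwxy
    · exact (hperm x z).trans hwxz
    · exact (hperm y z).trans hwyz

end Normalization

/-! ### Codes with prescribed weights -/

section Realization

variable {n : ℕ}

/-- There is a list of linear functionals, with multiplicities modulo eight, of which
`4 F(v)` modulo eight do not vanish at `v`. -/
def IsWeightFunction (F : (Fin n → ZMod 2) → ZMod 2) : Prop :=
  ∃ μ : (Fin n → ZMod 2) → ZMod 8, ∀ v,
    ∑ a, μ a * ((a ⬝ᵥ v).val : ZMod 8) = 4 * ((F v).val : ZMod 8)

theorem IsWeightFunction.add {F G : (Fin n → ZMod 2) → ZMod 2} (hF : IsWeightFunction F)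
    (hG : IsWeightFunction G) : IsWeightFunction (fun v => F v + G v) := by
  obtain ⟨μ, hμ⟩ := hF
  obtain ⟨ν, hν⟩ := hG
  have h : ∀ x y : ZMod 2, 4 * (((x + y).val : ℕ) : ZMod 8) =
      4 * ((x.val : ℕ) : ZMod 8) + 4 * ((y.val : ℕ) : ZMod 8) := by decide
  exact ⟨fun a => μ a + ν a, fun v => by
    simp only [h, add_mul, Finset.sum_add_distrib, hμ, hν]⟩

theorem isWeightFunction_zero : IsWeightFunction (fun _ : Fin n → ZMod 2 => 0) :=
  ⟨0, fun v => by simp⟩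

theorem IsWeightFunction.sum {ι : Type*} (s : Finset ι) {F : ι → (Fin n → ZMod 2) → ZMod 2}
    (hF : ∀ i, IsWeightFunction (F i)) : IsWeightFunction (fun v => ∑ i ∈ s, F i v) := by
  classical
  induction s using Finset.induction_on with
  | empty => simpa using isWeightFunction_zero
  | insert i s hi ih => simpa only [Finset.sum_insert hi] using (hF i).add ih

theorem IsWeightFunction.const_mul {F : (Fin n → ZMod 2) → ZMod 2} (hF : IsWeightFunction F)
    (c : ZMod 2) : IsWeightFunction (fun v => c * F v) := by
  have : c = 0 ∨ c = 1 := by revert c; decide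
  rcases this with rfl | rfl
  · simpa using isWeightFunction_zero
  · simpa using hF

/-- Inclusion and exclusion: for bits, `4xyz` is the sum of the values of `x, y, z` and `x + y + z`
minus those of the three pairwise sums, all sums inside values being taken modulo two. The
multiplicity 7 stands for `-1` modulo 8. Repeated factors give the monomials of lower degree. -/
theorem isWeightFunction_mul_mul (a b c : Fin n → ZMod 2) :
    IsWeightFunction (fun v => (a ⬝ᵥ v) * (b ⬝ᵥ v) * (c ⬝ᵥ v)) := by
  have h : ∀ x y z : ZMod 2, (x.val : ZMod 8) + (y.val : ZMod 8) + (z.val : ZMod 8) +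
      7 * ((x + y).val : ZMod 8) + 7 * ((x + z).val : ZMod 8) + 7 * ((y + z).val : ZMod 8) +
      ((x + y + z).val : ZMod 8) = 4 * ((x * y * z).val : ZMod 8) := by decide
  refine ⟨Pi.single a 1 + Pi.single b 1 + Pi.single c 1 + Pi.single (a + b) 7 +
    Pi.single (a + c) 7 + Pi.single (b + c) 7 + Pi.single (a + b + c) 1, fun v => ?_⟩
  simp only [Pi.add_apply, add_mul, Finset.sum_add_distrib, Pi.single_apply, ite_mul, zero_mul,
    one_mul, Finset.sum_ite_eq', Finset.mem_univ, if_true]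
  rw [← h]
  simp only [add_dotProduct]

theorem isWeightFunction_cubic (l : TriVec n) : IsWeightFunction (cubic l) := by
  have hsq : ∀ x : ZMod 2, x * x = x := by decide
  have h1 : ∀ i : Fin n, IsWeightFunction fun v => v i := fun i => by
    simpa [hsq] using isWeightFunction_mul_mul (Pi.single i 1 : Fin n → ZMod 2) (Pi.single i 1)
      (Pi.single i 1)
  have h2 : ∀ p : IncPair n, IsWeightFunction fun v => v p.1.2 * v p.1.1 := fun p => by
    simpa [hsq] using isWeightFunction_mul_mul (Pi.single p.1.2 1 : Fin n → ZMod 2)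
      (Pi.single p.1.2 1) (Pi.single p.1.1 1)
  have h3 : ∀ t : IncTriple n, IsWeightFunction fun v => v t.1.1 * v t.1.2.1 * v t.1.2.2 :=
    fun t => by
      simpa using isWeightFunction_mul_mul (Pi.single t.1.1 1 : Fin n → ZMod 2)
        (Pi.single t.1.2.1 1) (Pi.single t.1.2.2 1)
  have h : cubic l = fun v => (∑ i, l.1 i * v i + ∑ p, l.2.1 p * (v p.1.2 * v p.1.1)) +
      ∑ t, l.2.2 t * (v t.1.1 * v t.1.2.1 * v t.1.2.2) := by
    funext v
    have ht : ∀ x y z : ZMod 2, x * (y * z) + y * (x * z) + z * (x * y) = x * y * z := by decide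
    simp only [cubic, TriVec.pair, freeSquare, freeCocycle, hsq, ht]
  rw [h]
  exact ((IsWeightFunction.sum _ fun i => (h1 i).const_mul _).add
    (IsWeightFunction.sum _ fun p => (h2 p).const_mul _)).add
    (IsWeightFunction.sum _ fun t => (h3 t).const_mul _)

/-- Functions of degree at most three are the functions `|v| / 4` of doubly even codes. -/
theorem IsWeightFunction.exists_code {F : (Fin n → ZMod 2) → ZMod 2} (hF : IsWeightFunction F) :
    ∃ (N : ℕ) (T : (Fin n → ZMod 2) →ₗ[ZMod 2] (Fin N → ZMod 2)), Function.Injective T ∧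
      ∀ v, 4 ∣ binWeight (T v) ∧ ((binWeight (T v) / 4 : ℕ) : ZMod 2) = F v := by
  obtain ⟨μ, hμ⟩ := hF
  -- Adding 8 does not change multiplicities modulo 8 but makes every functional occur, in
  -- particular the coordinates, so that `T` is injective.
  let ι := Σ a : Fin n → ZMod 2, Fin ((μ a).val + 8)
  let ε := Fintype.equivFin ι
  let T : (Fin n → ZMod 2) →ₗ[ZMod 2] (Fin (Fintype.card ι) → ZMod 2) :=
    { toFun := fun v k => (ε.symm k).1 ⬝ᵥ v
      map_add' := fun u v => funext fun k => dotProduct_add _ _ _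
      map_smul' := fun c v => funext fun k => dotProduct_smul _ _ _ }
  have hT : ∀ v k, T v k = (ε.symm k).1 ⬝ᵥ v := fun _ _ => rfl
  refine ⟨Fintype.card ι, T, (injective_iff_map_eq_zero T).2 fun v hv => funext fun i => ?_,
    fun v => ?_⟩
  · have h := congrFun hv (ε ⟨Pi.single i 1, ⟨0, by omega⟩⟩)
    simpa [hT] using h
  · have hw : binWeight (T v) = ∑ a, ((μ a).val + 8) * (a ⬝ᵥ v).val := by
      rw [binWeight_eq_sum, ← ε.sum_comp, Fintype.sum_sigma]
      simp [hT]
    have h8 : (8 : ZMod 8) = 0 := by decide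
    have hc : ((binWeight (T v) : ℕ) : ZMod 8) = ((4 * (F v).val : ℕ) : ZMod 8) := by
      rw [hw, Nat.cast_mul, Nat.cast_ofNat, ← hμ]
      simp [h8]
    rw [ZMod.natCast_eq_natCast_iff'] at hc
    have hlt := ZMod.val_lt (F v)
    have h4 : 4 ∣ binWeight (T v) := by omega
    refine ⟨h4, ?_⟩
    have h2 : binWeight (T v) / 4 % 2 = (F v).val := by omega
    rw [← ZMod.natCast_zmod_val (F v), ← h2, ZMod.natCast_mod]

/-- The code has weights `4 * cubic l` modulo 8, and evenness of intersections follows from that of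
weights. The factor set is the free cocycle composed with the functional `l`. -/
theorem exists_codeLoop (l : TriVec n) : ∃ (L : CodeLoop)
    (e : (Fin n → ZMod 2) ≃ₗ[ZMod 2] L.code), ∀ v, L.square (e v) = cubic l v := by
  obtain ⟨N, T, hT, hw⟩ := (isWeightFunction_cubic l).exists_code
  have hV : IsDoublyEven (LinearMap.range T) :=
    { weight := by
        rintro _ ⟨v, rfl⟩
        exact (hw v).1
      inter := by
        rintro _ ⟨u, rfl⟩ _ ⟨v, rfl⟩
        have h := binWeight_add (T u) (T v)
        have h1 := (hw u).1
        have h2 := (hw v).1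
        have h3 := (hw (u + v)).1
        rw [map_add] at h3
        omega }
  let e := LinearEquiv.ofInjective T hT
  have he : ∀ v, quarterWeight (e v) = cubic l v := fun v => (hw v).2
  have hfac := (isCubicFactor_pair l).comp e.symm.toLinearMap
  have hsq : (fun v => cubic l (e.symm.toLinearMap v)) = quarterWeight := funext fun v => by
    rw [← he]
    simp
  rw [hsq] at hfac
  exact ⟨⟨N, LinearMap.range T, hV, _, isFactorSet_of_isCubicFactor hV hfac⟩, e, he⟩

end Realization

/-! ### The classification -/

namespace CodeLoop

theorem IsCharVector.nonassociative {L : CodeLoop} {x : Fin 4 → L.Carrier} {m : Fin 10 → ZMod 2}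
    (h : L.IsCharVector x (normalized m)) : L.Nonassociative := by
  refine nonassociative_iff.2 ⟨_, _, _,
    ((mul_assoc_signElt_iff _ _ _ _).1 (h.associator ⟨(0, 1, 2), by decide⟩)).trans ?_⟩
  simp [normalized]

/-- Code loops whose square functions have linearly equivalent coordinate expressions are
isomorphic. -/
theorem iso_of_linEquivalent {L M : CodeLoop} {l m : TriVec 4}
    (eL : (Fin 4 → ZMod 2) ≃ₗ[ZMod 2] L.code) (eM : (Fin 4 → ZMod 2) ≃ₗ[ZMod 2] M.code)
    (hL : ∀ v, L.square (eL v) = cubic l v) (hM : ∀ v, M.square (eM v) = cubic m v)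
    (h : LinEquivalent (cubic l) (cubic m)) : L.Iso M := by
  obtain ⟨g, hg⟩ := h
  refine iso_of_square_eq ((eL.symm.trans g).trans eM) fun v => ?_
  rw [LinearEquiv.trans_apply, LinearEquiv.trans_apply, hM, hg, ← hL, eL.apply_symm_apply]

theorem linEquivalent_of_iso {L M : CodeLoop} {l m : TriVec 4}
    (eL : (Fin 4 → ZMod 2) ≃ₗ[ZMod 2] L.code) (eM : (Fin 4 → ZMod 2) ≃ₗ[ZMod 2] M.code)
    (hL : ∀ v, L.square (eL v) = cubic l v) (hM : ∀ v, M.square (eM v) = cubic m v)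
    (hna : L.Nonassociative) (h : L.Iso M) : LinEquivalent (cubic l) (cubic m) := by
  obtain ⟨g, hg⟩ := exists_square_eq_of_iso hna h
  refine ⟨(eL.trans g).trans eM.symm, fun v => ?_⟩
  rw [← hM, ← hL, ← hg]
  simp

theorem Iso.symm {L M : CodeLoop} (h : L.Iso M) : M.Iso L := h.map MulEquiv.symm

theorem Iso.trans {L M N : CodeLoop} (h : L.Iso M) (h' : M.Iso N) : L.Iso N :=
  h.elim fun f => h'.map f.trans

end CodeLoop

theorem theorem3p5 :
    -- each characteristic vector defines a code loop of rank 4, unique up to isomorphism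
    (∀ i : Fin 16,
      (∃ L : CodeLoop, L.rank = 4 ∧ ∃ x, L.IsCharVector x (normalized (charVec i))) ∧
      ∀ L M : CodeLoop, L.rank = 4 → M.rank = 4 →
        (∃ x, L.IsCharVector x (normalized (charVec i))) →
        (∃ y, M.IsCharVector y (normalized (charVec i))) → L.Iso M) ∧
    -- the classification
    (∀ C : Fin 16 → CodeLoop,
      (∀ i, (C i).rank = 4 ∧ ∃ x, (C i).IsCharVector x (normalized (charVec i))) →
      (∀ i, (C i).Nonassociative) ∧
      (∀ L : CodeLoop, L.rank = 4 → L.Nonassociative → ∃! i, L.Iso (C i)) ∧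
      (∀ i j, i ≠ j → ¬ (C i).Iso (C j))) ∧
    -- the sizes of the orbits
    (∀ i, (charOrbit (charVec i)).ncard = orbitSize i) := by
  have hbasis : ∀ (L : CodeLoop) (m : Fin 10 → ZMod 2), L.rank = 4 →
      (∃ x, L.IsCharVector x (normalized m)) →
      ∃ e : (Fin 4 → ZMod 2) ≃ₗ[ZMod 2] L.code,
        ∀ v, L.square (e v) = cubic (normalized m) v := fun L m hL ⟨x, hx⟩ =>
    hx.exists_linearEquiv hL
  refine ⟨fun i => ⟨?_, fun L M hL hM hx hy => ?_⟩, fun C hC => ?_, ncard_charOrbit⟩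
  · obtain ⟨L, e, he⟩ := exists_codeLoop (normalized (charVec i))
    refine ⟨L, ?_, CodeLoop.exists_isCharVector _ e he⟩
    rw [CodeLoop.rank, ← e.finrank_eq, Module.finrank_fin_fun]
  · obtain ⟨eL, heL⟩ := hbasis L _ hL hx
    obtain ⟨eM, heM⟩ := hbasis M _ hM hy
    exact CodeLoop.iso_of_linEquivalent eL eM heL heM (LinEquivalent.refl _)
  · have hna : ∀ i, (C i).Nonassociative := fun i => (hC i).2.elim fun x hx => hx.nonassociative
    choose e he using fun i => hbasis (C i) _ (hC i).1 (hC i).2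
    have hinj : ∀ i j, (C i).Iso (C j) → i = j := fun i j h =>
      eq_of_weightInvariant_eq (CodeLoop.linEquivalent_of_iso (e i) (e j) (he i) (he j) (hna i)
        h).weightInvariant_eq
    refine ⟨hna, fun L hL hLna => ?_, fun i j hij h => hij (hinj i j h)⟩
    obtain ⟨x, y, z, hxyz⟩ := CodeLoop.nonassociative_iff.1 hLna
    obtain ⟨eL, m, heL⟩ := L.isCubic_square.exists_normalized hL hxyz
    obtain ⟨i, hi⟩ := exists_linEquivalent_charVec m
    have hLi : L.Iso (C i) := CodeLoop.iso_of_linEquivalent eL (e i) heL (he i) hi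
    exact ⟨i, hLi, fun j hLj => hinj j i (hLj.symm.trans hLi)⟩
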